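/- Setting. Let $w_0,w_1\ge 0$ with $w_0+w_1=1$, and let $\rho_0,\rho_1\in C^1(\mathbb R)$ be probability densities on $\mathbb R$. Let $\nu$ be the law of $(X,Y)\in\mathbb R\times\{0,1\}$ with $\mathbb P(Y=y)=w_y$ and with $X$ having density $\rho_y$ conditionally on $Y=y$, and let $\nu^S$ be the image of $\nu$ under the exchange of the two labels. Assume: (ii) there are only finitely many $t\in\mathbb R$ with $w_0\rho_0(t)=w_1\rho_1(t)>0$; (iii) $w_0\rho_0'(t)\ne w_1\rho_1'(t)$ for every $t\in\mathbb R$ with $w_0\rho_0(t)=w_1\rho_1(t)>0$. Let $A_0\subseteq\mathbb R$ be (the set of) a Bayes classifier, i.e. $w_0\rho_0\le w_1\rho_1$ on $A_0$ and $w_1\rho_1\le w_0\rho_0$ on $\mathbb R\setminus A_0$, whose decision boundary lies where there is data: $w_0\rho_0(t)+w_1\rho_1(t)>0$ for every $t\in\partial A_0$. Notation. For $\varepsilon\ge0$ and Borel $A\subseteq\mathbb R$ the adversarial risk is $$R_\varepsilon(\mathbf 1_A)=\sup_{g}\ \nu\big(\{(x,y):\mathbf 1_A(g(x,y))\neq y\}\big),$$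 the supremum being over measurable $g:\mathbb R\times\{0,1\}\to\mathbb R$ with $|g(x,y)-x|\le\varepsilon$ for all $(x,y)$. Let $\tilde d_A(x)=d(x,A)$ for $x\notin A$ and $\tilde d_A(x)=-d(x,A^c)$ for $x\in A$ (with $d(x,\emptyset)=+\infty$), and $A^{s}=\{x:\tilde d_A(x)\le s\}$ for $s\in\mathbb R$. Let $c_\varepsilon((x_1,y_1),(x_2,y_2))=1$ if $|x_1-x_2|>2\varepsilon$ or $y_1\ne y_2$, and $0$ otherwise. $\Gamma(\nu,\nu^S)$ is the set of couplings of $\nu$ and $\nu^S$. Theorem. The interior of $A_0$ is a finite union $\bigcup_{i=1}^K(a_i(0),b_i(0))$ with $-\infty\le a_1(0)<b_1(0)<a_2(0)<\dots<a_K(0)<b_K(0)\le+\infty$ ($K=0$ being allowed), and there is $\varepsilon_0>0$ such that the following holds. The decoupled equations $$\frac{db_i}{d\varepsilon}=-\frac{w_0\rho_0'(b_i+\varepsilon)+w_1\rho_1'(b_i-\varepsilon)}{w_0\rho_0'(b_i+\varepsilon)-w_1\rho_1'(b_i-\varepsilon)},\qquad \frac{da_i}{d\varepsilon}=-\frac{w_1\rho_1'(a_i+\varepsilon)+w_0\rho_0'(a_i-\varepsilon)}{w_1\rho_1'(a_i+\varepsilon)-w_0\rho_0'(a_i-\varepsilon)}$$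 for the finite endpoints, with initial values $a_i(0)$, $b_i(0)$, have a solution on $[0,\varepsilon_0]$ along which the denominators do not vanish; infinite endpoints are kept infinite. For every such solution and every $\varepsilon\in[0,\varepsilon_0]$, the set $A^*_\varepsilon=\bigcup_{i=1}^K(a_i(\varepsilon),b_i(\varepsilon))$ satisfies: 1. there is a coupling $\pi_\varepsilon\in\Gamma(\nu,\nu^S)$ with $$w_1\int_{(A^*_\varepsilon)^{-\varepsilon}}\rho_1\,dx-w_0\int_{(A^*_\varepsilon)^{\varepsilon}}\rho_0\,dx=\frac12\int c_\varepsilon(z_1,z_2)\,d\pi_\varepsilon(z_1,z_2)+\frac12(w_1-w_0);$$ 2. $A^*_\varepsilon$ is a global minimizer of the adversarial risk: $R_\varepsilon(\mathbf 1_{A^*_\varepsilon})\le R_\varepsilon(\mathbf 1_B)$ for every Borel set $B\subseteq\mathbb R$. -/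

import Mathlib

open MeasureTheory Set
open scoped ENNReal

noncomputable section

namespace AdvClass

/-- A data point: a feature in `ℝ` together with a label in `{0, 1}`. -/
abbrev Datum : Type := ℝ × Fin 2

/-- `f` is a probability density with respect to Lebesgue measure on `ℝ`. -/
structure IsProbDensity (f : ℝ → ℝ) : Prop where
  nonneg : ∀ x, 0 ≤ f x
  integrable : Integrable f
  integral_eq_one : ∫ x, f x = 1

/-- The data distribution: label `y` has probability `w y`, and conditionally on the label `y`
the feature has density `ρ y`. -/
def dataMeasure (w : Fin 2 → ℝ) (ρ : Fin 2 → ℝ → ℝ) : Measure Datum :=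
  ∑ y : Fin 2, ENNReal.ofReal (w y) •
    (volume.withDensity (fun x => ENNReal.ofReal (ρ y x))).map (fun x => (x, y))

/-- The measure obtained by exchanging the two labels. -/
def swapLabels (ν : Measure Datum) : Measure Datum :=
  ν.map (fun z => (z.1, 1 - z.2))

/-- The couplings of `μ` and `ν`: probability measures with these first and second marginals. -/
def couplings (μ ν : Measure Datum) : Set (Measure (Datum × Datum)) :=
  {π | IsProbabilityMeasure π ∧ π.fst = μ ∧ π.snd = ν}

open Classical in
/-- The cost `c_ε`: the indicator of `{d(x₁, x₂) > 2 ε} ∪ {y₁ ≠ y₂}`. -/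
def transportCost (ε : ℝ) (z₁ z₂ : Datum) : ℝ :=
  if 2 * ε < dist z₁.1 z₂.1 ∨ z₁.2 ≠ z₂.2 then 1 else 0

open Classical in
/-- The signed distance to `A`, in the extended reals: the distance to the empty set is `+∞`. -/
def extSignedDist (A : Set ℝ) (x : ℝ) : EReal :=
  if x ∈ A then -((Metric.infEDist x Aᶜ : ℝ≥0∞) : EReal)
  else ((Metric.infEDist x A : ℝ≥0∞) : EReal)

/-- The set `A^s`: a dilation of `A` for `s > 0`, an erosion of `A` for `s < 0`. -/
def offsetSet (A : Set ℝ) (s : ℝ) : Set ℝ := {x | extSignedDist A x ≤ (s : EReal)}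

open Classical in
/-- The classifier `1_A`. -/
def classifier (A : Set ℝ) (x : ℝ) : Fin 2 := if x ∈ A then 1 else 0

/-- The 0-1 loss. -/
def zeroOneLoss (p y : Fin 2) : ℝ≥0∞ := if p ≠ y then 1 else 0

/-- The adversarial risk `R_ε(f)`: the supremum of the expected 0-1 loss over all (measurable)
perturbations `g(x, y)` of the feature by a distance at most `ε`. -/
def robustRisk (ν : Measure Datum) (ε : ℝ) (f : ℝ → Fin 2) : ℝ≥0∞ :=
  ⨆ (g : Datum → ℝ) (_ : Measurable g) (_ : ∀ z, dist (g z) z.1 ≤ ε),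
    ∫⁻ z, zeroOneLoss (f (g z)) z.2 ∂ν

/-- `A` is a solution of the robust classification problem: it minimizes `R_ε(1_B)` over all
Borel sets `B`. -/
def IsRobustOptimal (ν : Measure Datum) (ε : ℝ) (A : Set ℝ) : Prop :=
  MeasurableSet A ∧
    ∀ B : Set ℝ, MeasurableSet B → robustRisk ν ε (classifier A) ≤ robustRisk ν ε (classifier B)

/-- `1_A` is a Bayes classifier: it selects at every point a label whose weighted density is
largest (ties are broken arbitrarily). -/
def IsBayesSet (w : Fin 2 → ℝ) (ρ : Fin 2 → ℝ → ℝ) (A : Set ℝ) : Prop :=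
  ∀ x, (x ∈ A → w 0 * ρ 0 x ≤ w 1 * ρ 1 x) ∧ (x ∉ A → w 1 * ρ 1 x ≤ w 0 * ρ 0 x)

/-- The union of the open intervals `(a i, b i)` of the real line, with endpoints in `[-∞, +∞]`. -/
def intervalUnion {K : ℕ} (a b : Fin K → EReal) : Set ℝ :=
  {x | ∃ i, a i < (x : EReal) ∧ (x : EReal) < b i}

/-- `a` and `b` list, in increasing order `a₁ < b₁ < a₂ < ⋯ < a_K < b_K`, the endpoints of the
intervals that constitute `A` (up to boundary points). Given `A`, such a list is unique. -/
structure IsBoundary (A : Set ℝ) {K : ℕ} (a b : Fin K → EReal) : Prop where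
  lt : ∀ i, a i < b i
  lt_of_lt : ∀ i j, i < j → b i < a j
  union_eq : intervalUnion a b = interior A

/-- The trajectory `c` starts at `c₀` and, if `c₀` is finite, solves `dc/dε = - N(ε, c) / D(ε, c)`
on `[0, T]`, with a denominator that does not vanish along the trajectory. An infinite `c₀` does not
move. -/
def EndpointEvolves (N D : ℝ → ℝ → ℝ) (T : ℝ) (c₀ : EReal) (c : ℝ → EReal) : Prop :=
  ((c₀ = ⊥ ∨ c₀ = ⊤) ∧ ∀ ε ∈ Icc 0 T, c ε = c₀) ∨
  ∃ y : ℝ → ℝ, c₀ = (y 0 : EReal) ∧ (∀ ε ∈ Icc 0 T, c ε = (y ε : EReal)) ∧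
    ∀ ε ∈ Icc 0 T, D ε (y ε) ≠ 0 ∧
      HasDerivWithinAt y (-(N ε (y ε) / D ε (y ε))) (Icc 0 T) ε

/-- The endpoints `a i`, `b i` solve on `[0, T]` the decoupled evolution equations with initial
values `a₀ i`, `b₀ i`. -/
def SolvesEvolution (w : Fin 2 → ℝ) (ρ : Fin 2 → ℝ → ℝ) (T : ℝ) {K : ℕ}
    (a₀ b₀ : Fin K → EReal) (a b : Fin K → ℝ → EReal) : Prop :=
  ∀ i,
    EndpointEvolves
      (fun ε t => w 1 * deriv (ρ 1) (t + ε) + w 0 * deriv (ρ 0) (t - ε))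
      (fun ε t => w 1 * deriv (ρ 1) (t + ε) - w 0 * deriv (ρ 0) (t - ε))
      T (a₀ i) (a i) ∧
    EndpointEvolves
      (fun ε t => w 0 * deriv (ρ 0) (t + ε) + w 1 * deriv (ρ 1) (t - ε))
      (fun ε t => w 0 * deriv (ρ 0) (t + ε) - w 1 * deriv (ρ 1) (t - ε))
      T (b₀ i) (b i)

end AdvClass

end

open AdvClass

noncomputable section

namespace AdvClass

open Filter Topology intervalIntegral

/-! Write f = w₀ρ₀ and g = w₁ρ₁. The proof is a duality certificate.

Weak duality (`one_le_two_mul_robustRisk_add`): two points that a coupling of ν and ν^S pairs at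
zero cost carry opposite true labels and lie within 2ε of each other. Both can be moved to their
midpoint, where any classifier errs on one of them. Hence 1 ≤ 2 R_ε(1_B) + π{c_ε = 1} for every B.
On the other side, R_ε(1_A) ≤ M, where M is the f-mass of A^ε plus the g-mass of the complement of
A^{-ε} (`robustRisk_le_offsetSet`). So it suffices to match a part of f dx with a part of g dx, with
displacement at most 2ε and total mass at least M. Used in both directions and completed arbitrarily
(`exists_coupling_of_matching`), such a matching gives π with 2M + π{c_ε = 1} ≤ 1. All inequalities
are then equalities, which yields both conclusions (`optimal_of_matching`).

The matching: away from the endpoints the diagonal coupling of min(f, g) is enough. At a left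
endpoint g - f crosses zero upwards with positive slope, and the evolution equation is the
derivative in ε of g(a + ε) = f(a - ε), which every solution therefore satisfies. Take a window [q,
p] on which f over [q, a - ε] balances g over [q, a + ε], and f over [a - ε, p] balances g over [a +
ε, p]. The distribution functions F, G on the window satisfy G ≤ F, since f - g passes from
nonnegative to nonpositive. They also satisfy F(x) ≤ G(x + 2ε): the difference vanishes at x = a -
ε, and so does its derivative g(x + 2ε) - f(x), which is increasing. Hence the quantile coupling has
displacement at most 2ε (`IsUpcrossing.exists_coupling`), and its mass is the window's share of M.
Right endpoints are the same with f and g exchanged; `exists_matching_of_isWindow` glues the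
windows. -/

/-! ### The quantile coupling on the real line -/

/-- The quantile function of a finite measure on the real line. -/
def quantile (μ : Measure ℝ) (u : ℝ) : ℝ := sInf {x | ENNReal.ofReal u ≤ μ (Iic x)}

theorem tendsto_measure_Iic_atBot_zero (μ : Measure ℝ) [IsFiniteMeasure μ] :
    Tendsto (fun x => μ (Iic x)) atBot (𝓝 0) := by
  have h := tendsto_measure_iInter_atBot (μ := μ) (s := fun x : ℝ => Iic x)
    (fun _ => measurableSet_Iic.nullMeasurableSet) (fun _ _ h => Iic_subset_Iic.2 h)
    ⟨0, measure_ne_top _ _⟩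
  have he : ⋂ x : ℝ, Iic x = ∅ := by
    ext y
    simp only [mem_iInter, mem_Iic, mem_empty_iff_false, iff_false, not_forall, not_le]
    exact ⟨y - 1, by linarith⟩
  rwa [he, measure_empty] at h

theorem tendsto_measure_Iic_nhdsGT (μ : Measure ℝ) [IsFiniteMeasure μ] (x : ℝ) :
    Tendsto (fun y => μ (Iic y)) (𝓝[>] x) (𝓝 (μ (Iic x))) := by
  have h := tendsto_measure_biInter_gt (μ := μ) (s := fun x : ℝ => Iic x) (a := x)
    (fun _ _ => measurableSet_Iic.nullMeasurableSet) (fun _ _ _ h => Iic_subset_Iic.2 h)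
    ⟨x + 1, by simp, measure_ne_top _ _⟩
  have he : ⋂ r, ⋂ (_ : r > x), Iic r = Iic x := by
    ext y
    simp only [mem_iInter, mem_Iic]
    exact ⟨fun h => le_of_forall_gt_imp_ge_of_dense h, fun h r hr => h.trans hr.le⟩
  rwa [he] at h

/-- Right continuity of the distribution function makes the infimum attained; the bounds on `u` make
the set bounded below and nonempty. All later facts on quantiles come from this equivalence. -/
theorem quantile_le_iff (μ : Measure ℝ) [IsFiniteMeasure μ] {u x : ℝ} (hu : 0 < u)
    (hu' : u < μ.real univ) : quantile μ u ≤ x ↔ ENNReal.ofReal u ≤ μ (Iic x) := by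
  have hbdd : BddBelow {x | ENNReal.ofReal u ≤ μ (Iic x)} := by
    have := (tendsto_measure_Iic_atBot_zero μ).eventually_lt_const
      (show 0 < ENNReal.ofReal u by simpa using hu)
    obtain ⟨y, hy⟩ := this.exists
    refine ⟨y, fun z hz => ?_⟩
    by_contra! hlt
    exact absurd hy (not_lt.2 (le_trans hz (measure_mono (Iic_subset_Iic.2 hlt.le))))
  have hne : {x | ENNReal.ofReal u ≤ μ (Iic x)}.Nonempty := by
    have hlt : ENNReal.ofReal u < μ univ := by
      rw [← ofReal_measureReal (measure_ne_top μ univ)]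
      exact (ENNReal.ofReal_lt_ofReal_iff (hu.trans hu')).2 hu'
    obtain ⟨y, hy⟩ := ((tendsto_measure_Iic_atTop μ).eventually_const_lt hlt).exists
    exact ⟨y, hy.le⟩
  constructor
  · intro h
    refine ge_of_tendsto (tendsto_measure_Iic_nhdsGT μ x) ?_
    filter_upwards [self_mem_nhdsWithin] with y hy
    obtain ⟨s, hs, hsy⟩ := exists_lt_of_csInf_lt hne (lt_of_le_of_lt h hy)
    exact le_trans hs (measure_mono (Iic_subset_Iic.2 hsy.le))
  · exact fun h => csInf_le hbdd h

theorem aemeasurable_quantile (μ : Measure ℝ) [IsFiniteMeasure μ] :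
    AEMeasurable (quantile μ) (volume.restrict (Ioo 0 (μ.real univ))) := by
  refine aemeasurable_restrict_of_monotoneOn measurableSet_Ioo ?_
  intro u hu v hv huv
  rw [quantile_le_iff μ hu.1 hu.2]
  exact (ENNReal.ofReal_le_ofReal huv).trans ((quantile_le_iff μ hv.1 hv.2).1 le_rfl)

theorem map_quantile (μ : Measure ℝ) [IsFiniteMeasure μ] :
    (volume.restrict (Ioo 0 (μ.real univ))).map (quantile μ) = μ := by
  refine Measure.ext_of_Iic _ _ fun x => ?_
  rw [Measure.map_apply_of_aemeasurable (aemeasurable_quantile μ) measurableSet_Iic]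
  have hle : μ.real (Iic x) ≤ μ.real univ := measureReal_mono (subset_univ _)
  have hset : quantile μ ⁻¹' Iic x =ᵐ[volume.restrict (Ioo 0 (μ.real univ))]
      Iic (μ.real (Iic x)) := by
    filter_upwards [ae_restrict_mem measurableSet_Ioo] with u hu
    have : quantile μ u ≤ x ↔ u ≤ μ.real (Iic x) := by
      rw [quantile_le_iff μ hu.1 hu.2, ENNReal.ofReal_le_iff_le_toReal (measure_ne_top _ _)]
      rfl
    exact propext this
  rw [measure_congr hset, Measure.restrict_apply measurableSet_Iic]
  have hae : (Iic (μ.real (Iic x)) ∩ Ioo 0 (μ.real univ) : Set ℝ) =ᵐ[volume]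
      Ioc 0 (μ.real (Iic x)) := by
    have h1 : ∀ᵐ u : ℝ, u ≠ μ.real univ := by simp [ae_iff, measure_singleton]
    filter_upwards [h1] with u hu
    refine propext ⟨fun h => ⟨h.2.1, h.1⟩, fun h => ⟨h.2, h.1, lt_of_le_of_ne (h.2.trans hle) hu⟩⟩
  rw [measure_congr hae, Real.volume_Ioc, sub_zero, ofReal_measureReal]

/-- Two finite measures of the same mass whose distribution functions are within a translation by
`η` of each other can be coupled with a displacement at most `η`. -/
theorem exists_monotone_coupling (μ ν : Measure ℝ) [IsFiniteMeasure μ] [IsFiniteMeasure ν]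
    (η : ℝ) (hmass : μ univ = ν univ) (h₁ : ∀ x, ν (Iic x) ≤ μ (Iic x))
    (h₂ : ∀ x, μ (Iic x) ≤ ν (Iic (x + η))) :
    ∃ σ : Measure (ℝ × ℝ), σ.fst = μ ∧ σ.snd = ν ∧ ∀ᵐ z ∂σ, dist z.1 z.2 ≤ η := by
  have hreal : μ.real univ = ν.real univ := by simp [measureReal_def, hmass]
  have hμ := aemeasurable_quantile μ
  have hν := aemeasurable_quantile ν
  rw [← hreal] at hν
  refine ⟨(volume.restrict (Ioo 0 (μ.real univ))).map (fun u => (quantile μ u, quantile ν u)),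
    ?_, ?_, ?_⟩
  · rw [Measure.fst, AEMeasurable.map_map_of_aemeasurable measurable_fst.aemeasurable
      (hμ.prodMk hν)]
    exact map_quantile μ
  · rw [Measure.snd, AEMeasurable.map_map_of_aemeasurable measurable_snd.aemeasurable
      (hμ.prodMk hν)]
    have := map_quantile ν
    rwa [← hreal] at this
  · rw [ae_map_iff (hμ.prodMk hν) (measurableSet_le (by fun_prop) (by fun_prop))]
    filter_upwards [ae_restrict_mem measurableSet_Ioo] with u hu
    have a1 : quantile μ u ≤ quantile ν u := by
      rw [quantile_le_iff μ hu.1 hu.2]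
      exact ((quantile_le_iff ν hu.1 (hreal ▸ hu.2)).1 le_rfl).trans (h₁ _)
    have a2 : quantile ν u ≤ quantile μ u + η := by
      rw [quantile_le_iff ν hu.1 (hreal ▸ hu.2)]
      exact ((quantile_le_iff μ hu.1 hu.2).1 le_rfl).trans (h₂ _)
    rw [Real.dist_eq, abs_sub_comm, abs_of_nonneg (by linarith)]
    linarith

/-! ### Level sets of the distance function -/

/-- A point `x` of the level set has a nearest point `p` in the closure of `S`, and no level point
is closer than `ε` to `p`. So `x` is isolated on the side of `p`, and a set of one-sidedly isolated
points is countable. This makes open and closed `ε`-neighbourhoods interchangeable up to null sets.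
-/
theorem volume_infEDist_eq_ofReal (S : Set ℝ) {ε : ℝ} (hε : 0 < ε) :
    volume {x | Metric.infEDist x S = ENNReal.ofReal ε} = 0 := by
  set T := {x | Metric.infEDist x S = ENNReal.ofReal ε} with hT
  have hcount : T.Countable := by
    have key : T ⊆ {x ∈ T | ∃ z, id x < z ∧ ∀ y ∈ T, x < y → z ≤ id y} ∪
        {x ∈ T | ∃ z, z < id x ∧ ∀ y ∈ T, y < x → id y ≤ z} := by
      intro x hx
      have hne : S.Nonempty := by
        by_contra h
        rw [not_nonempty_iff_eq_empty] at h
        simp [hT, h] at hx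
      have hxc : Metric.infEDist x (closure S) = ENNReal.ofReal ε := by
        rw [Metric.infEDist_closure]; exact hx
      obtain ⟨p, hp, hpd⟩ := isClosed_closure.exists_infDist_eq_dist hne.closure x
      have hd : dist x p = ε := by
        rw [← hpd, Metric.infDist, hxc, ENNReal.toReal_ofReal hε.le]
      have hout : ∀ z, dist z p < ε → z ∉ T := by
        intro z hz hzT
        have h1 : Metric.infEDist z S ≤ edist z p := by
          rw [← Metric.infEDist_closure]; exact Metric.infEDist_le_edist_of_mem hp
        rw [show Metric.infEDist z S = ENNReal.ofReal ε from hzT, edist_dist] at h1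
        exact absurd hz (not_lt.2 ((ENNReal.ofReal_le_ofReal_iff dist_nonneg).1 h1))
      rw [Real.dist_eq] at hd
      rcases le_total x p with h | h
      · rw [abs_of_nonpos (by linarith)] at hd
        refine Or.inl ⟨hx, p, by simp only [id]; linarith, ?_⟩
        intro z hz hxz
        by_contra! hzp
        refine hout z ?_ hz
        simp only [id] at hzp
        rw [Real.dist_eq, abs_lt]; constructor <;> linarith
      · rw [abs_of_nonneg (by linarith)] at hd
        refine Or.inr ⟨hx, p, by simp only [id]; linarith, ?_⟩
        intro z hz hxz
        by_contra! hzp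
        refine hout z ?_ hz
        simp only [id] at hzp
        rw [Real.dist_eq, abs_lt]; constructor <;> linarith
    exact ((countable_image_lt_image_Ioi_within T id).union
      (countable_image_lt_image_Iio_within T id)).mono key
  exact hcount.measure_zero _

/-! ### Measures on labelled data -/

/-- The measure on labelled data whose restriction to the label `y` is `μ y`. -/
def labelMeasure (μ : Fin 2 → Measure ℝ) : Measure Datum := ∑ y : Fin 2, (μ y).map (fun x => (x, y))

theorem lintegral_labelMeasure (μ : Fin 2 → Measure ℝ) {h : Datum → ℝ≥0∞} (hh : Measurable h) :
    ∫⁻ z, h z ∂labelMeasure μ = ∫⁻ x, h (x, 0) ∂μ 0 + ∫⁻ x, h (x, 1) ∂μ 1 := by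
  rw [labelMeasure, Fin.sum_univ_two, lintegral_add_measure,
    lintegral_map hh (by fun_prop), lintegral_map hh (by fun_prop)]

theorem labelMeasure_apply (μ : Fin 2 → Measure ℝ) {s : Set Datum} (hs : MeasurableSet s) :
    labelMeasure μ s = μ 0 {x | (x, 0) ∈ s} + μ 1 {x | (x, 1) ∈ s} := by
  rw [labelMeasure, Fin.sum_univ_two, Measure.add_apply,
    Measure.map_apply (by fun_prop) hs, Measure.map_apply (by fun_prop) hs]
  rfl

theorem ae_labelMeasure (μ : Fin 2 → Measure ℝ) {P : Datum → Prop}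
    (h : ∀ y, ∀ᵐ x ∂μ y, P (x, y)) : ∀ᵐ z ∂labelMeasure μ, P z := by
  have h' : ∀ y, ∀ᵐ z ∂(μ y).map (fun x => (x, y)), P z := fun y =>
    ((measurableEmbedding_prod_mk_right y).ae_map_iff).2 (h y)
  rw [labelMeasure, Fin.sum_univ_two, ae_add_measure_iff]
  exact ⟨h' 0, h' 1⟩

theorem measurable_swapLabel : Measurable (fun z : Datum => ((z.1, 1 - z.2) : Datum)) :=
  measurable_fst.prodMk ((measurable_of_finite (fun y : Fin 2 => 1 - y)).comp measurable_snd)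

theorem swapLabels_labelMeasure (μ : Fin 2 → Measure ℝ) :
    swapLabels (labelMeasure μ) = labelMeasure (fun y => μ (1 - y)) := by
  ext s hs
  rw [swapLabels, Measure.map_apply measurable_swapLabel hs, labelMeasure_apply _ hs,
    labelMeasure_apply _ (measurable_swapLabel hs), add_comm]
  rfl

instance (μ : Fin 2 → Measure ℝ) [∀ y, IsFiniteMeasure (μ y)] : IsFiniteMeasure (labelMeasure μ) := by
  rw [labelMeasure]; infer_instance

theorem labelMeasure_mono {μ ν : Fin 2 → Measure ℝ} (h : ∀ y, μ y ≤ ν y) :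
    labelMeasure μ ≤ labelMeasure ν := by
  refine Measure.le_iff.2 fun s hs => ?_
  rw [labelMeasure_apply _ hs, labelMeasure_apply _ hs]
  exact add_le_add (h 0 _) (h 1 _)

/-! ### The adversarial risk -/

theorem measurable_classifier {A : Set ℝ} (hA : MeasurableSet A) : Measurable (classifier A) := by
  classical
  exact Measurable.ite hA measurable_const measurable_const

theorem measurable_zeroOneLoss {f : Datum → Fin 2} (hf : Measurable f) :
    Measurable (fun z : Datum => zeroOneLoss (f z) z.2) :=
  (measurable_of_finite (fun p : Fin 2 × Fin 2 => zeroOneLoss p.1 p.2)).comp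
    (hf.prodMk measurable_snd)

/-- Up to a null set, the points at distance at most `ε` from `B` can be moved into `B` in a
measurable way by a displacement at most `ε`. -/
theorem exists_measurable_perturbation (B : Set ℝ) {ε : ℝ} (hε : 0 ≤ ε) :
    ∃ g : ℝ → ℝ, Measurable g ∧ (∀ x, dist (g x) x ≤ ε) ∧
      ∀ᵐ x, (∃ b ∈ B, dist x b ≤ ε) → g x ∈ B := by
  rcases hε.eq_or_lt with rfl | hε
  · refine ⟨id, measurable_id, by simp, ae_of_all _ ?_⟩
    rintro x ⟨b, hb, hxb⟩
    rwa [id, dist_le_zero.1 hxb]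
  rcases B.eq_empty_or_nonempty with rfl | hne
  · exact ⟨id, measurable_id, by simp [hε.le], by simp⟩
  have := hne.to_subtype
  let d : ℕ → ℝ := fun n => TopologicalSpace.denseSeq B n
  have hd : ∀ x, (∃ b ∈ B, dist x b < ε) → ∃ n, dist x (d n) < ε := by
    rintro x ⟨b, hb, hxb⟩
    obtain ⟨n, hn⟩ := (TopologicalSpace.denseRange_denseSeq B).exists_mem_open
      (s := {c : B | dist x (c : ℝ) < ε})
      (isOpen_lt (by fun_prop) continuous_const) ⟨⟨b, hb⟩, hxb⟩
    exact ⟨n, hn⟩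
  classical
  -- The second alternative only ensures that `Nat.find` has a witness off `U`; it never holds on
  -- `U`.
  let p : ℝ → ℕ → Prop := fun x n => dist x (d n) < ε ∨ ∀ m, ¬ dist x (d m) < ε
  have hp : ∀ x, ∃ n, p x n := fun x => by
    by_cases h : ∃ n, dist x (d n) < ε
    · exact h.imp fun n hn => Or.inl hn
    · push Not at h
      exact ⟨0, Or.inr fun m => not_lt.2 (h m)⟩
  have hmeas : ∀ n, MeasurableSet {x | dist x (d n) < ε} := fun n =>
    measurableSet_lt (by fun_prop) measurable_const
  have hpm : ∀ n, MeasurableSet {x | p x n} := fun n =>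
    (hmeas n).union (by
      have : {x | ∀ m, ¬ dist x (d m) < ε} = ⋂ m, {x | dist x (d m) < ε}ᶜ := by
        ext; simp
      change MeasurableSet {x | ∀ m, ¬ dist x (d m) < ε}
      rw [this]
      exact MeasurableSet.iInter fun m => (hmeas m).compl)
  let U : Set ℝ := {x | ∃ n, dist x (d n) < ε}
  have hU : MeasurableSet U := by
    have : U = ⋃ n, {x | dist x (d n) < ε} := by ext; simp [U]
    rw [this]
    exact MeasurableSet.iUnion hmeas
  have hfind : ∀ x ∈ U, dist x (d (Nat.find (hp x))) < ε := by
    rintro x ⟨n, hn⟩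
    exact (Nat.find_spec (hp x)).resolve_right fun h => h n hn
  refine ⟨fun x => if x ∈ U then d (Nat.find (hp x)) else x, ?_, ?_, ?_⟩
  · refine Measurable.ite hU ?_ measurable_id
    exact (measurable_of_countable d).comp (measurable_find hp hpm)
  · intro x
    dsimp only
    split_ifs with h
    · rw [dist_comm]; exact (hfind x h).le
    · simpa using hε.le
  -- The construction reaches `B` only from points at distance less than `ε`; distance exactly `ε`
  -- is a null event.
  · have hnull := volume_infEDist_eq_ofReal B hε
    filter_upwards [measure_eq_zero_iff_ae_notMem.1 hnull] with x hx
    rintro ⟨b, hb, hxb⟩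
    have hxU : x ∈ U := by
      refine hd x ?_
      by_contra! hfar
      refine hx (le_antisymm ?_ ?_)
      · refine (Metric.infEDist_le_edist_of_mem hb).trans ?_
        rw [edist_dist]
        exact ENNReal.ofReal_le_ofReal hxb
      · refine Metric.le_infEDist.2 fun c hc => ?_
        rw [edist_dist]
        exact ENNReal.ofReal_le_ofReal (hfar c hc)
    simp only [hxU, if_true]
    exact Subtype.coe_prop _

theorem measurableSet_transportCost (ε : ℝ) :
    MeasurableSet {z : Datum × Datum | 2 * ε < dist z.1.1 z.2.1 ∨ z.1.2 ≠ z.2.2} := by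
  refine MeasurableSet.union ?_ ?_
  · exact measurableSet_lt measurable_const
      ((measurable_fst.comp measurable_fst).dist (measurable_fst.comp measurable_snd))
  · exact (measurableSet_eq_fun (f := fun z : Datum × Datum => z.1.2) (g := fun z => z.2.2)
      (by fun_prop) (by fun_prop)).compl

theorem transportCost_eq_indicator (ε : ℝ) :
    (fun z : Datum × Datum => transportCost ε z.1 z.2) =
      {z : Datum × Datum | 2 * ε < dist z.1.1 z.2.1 ∨ z.1.2 ≠ z.2.2}.indicator 1 := by
  classical
  ext z
  simp [transportCost, indicator]

theorem integral_transportCost (ε : ℝ) (π : Measure (Datum × Datum)) :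
    ∫ z, transportCost ε z.1 z.2 ∂π =
      π.real {z : Datum × Datum | 2 * ε < dist z.1.1 z.2.1 ∨ z.1.2 ≠ z.2.2} := by
  rw [transportCost_eq_indicator, integral_indicator_one (measurableSet_transportCost ε)]

theorem zeroOneLoss_self_of_ne {p y : Fin 2} (h : p ≠ y) : zeroOneLoss p y = 1 := if_pos h

/-- Weak duality: the cost of any coupling of the data with the swapped data bounds the adversarial
risk of any classifier from below. -/
theorem one_le_two_mul_robustRisk_add (μ : Fin 2 → Measure ℝ) (hμ : ∀ y, μ y ≪ volume)
    {ε : ℝ} (hε : 0 ≤ ε) {π : Measure (Datum × Datum)}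
    (hπ : π ∈ couplings (labelMeasure μ) (swapLabels (labelMeasure μ)))
    {B : Set ℝ} (hB : MeasurableSet B) :
    1 ≤ 2 * robustRisk (labelMeasure μ) ε (classifier B) +
      π {z : Datum × Datum | 2 * ε < dist z.1.1 z.2.1 ∨ z.1.2 ≠ z.2.2} := by
  obtain ⟨hprob, hfst, hsnd⟩ := hπ
  obtain ⟨g₀, hg₀, hd₀, hm₀⟩ := exists_measurable_perturbation B hε
  obtain ⟨g₁, hg₁, hd₁, hm₁⟩ := exists_measurable_perturbation Bᶜ hε
  -- The attack pushes class 0 into `B` and class 1 into the complement of `B`.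
  let g : Datum → ℝ := fun z => if z.2 = 0 then g₀ z.1 else g₁ z.1
  have hg : Measurable g := Measurable.ite
    (measurable_snd (measurableSet_singleton 0)) (hg₀.comp measurable_fst) (hg₁.comp measurable_fst)
  have hgd : ∀ z, dist (g z) z.1 ≤ ε := fun z => by
    dsimp only [g]; split_ifs
    exacts [hd₀ _, hd₁ _]
  let ℓ : Datum → ℝ≥0∞ := fun z => zeroOneLoss (classifier B (g z)) z.2
  have hℓ : Measurable ℓ := measurable_zeroOneLoss ((measurable_classifier hB).comp hg)
  let S : Datum → Datum := fun z => (z.1, 1 - z.2)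
  have hS : Measurable S := measurable_swapLabel
  have hℓ1 : ∀ᵐ z ∂labelMeasure μ, (∃ b, dist z.1 b ≤ ε ∧ classifier B b ≠ z.2) → ℓ z = 1 := by
    refine ae_labelMeasure μ fun y => (hμ y).ae_le ?_
    filter_upwards [hm₀, hm₁] with x h0 h1
    rintro ⟨b, hb, hby⟩
    refine zeroOneLoss_self_of_ne ?_
    fin_cases y
    · have hbB : b ∈ B := by
        by_contra h; simp [classifier, h] at hby
      simp [classifier, g, h0 ⟨b, hbB, hb⟩]
    · have hbB : b ∈ Bᶜ := by
        intro h; simp [classifier, h] at hby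
      have := h1 ⟨b, hbB, hb⟩
      simp only [mem_compl_iff] at this
      simp [classifier, g, this]
  have hint : ∫⁻ z, ℓ z ∂labelMeasure μ ≤ robustRisk (labelMeasure μ) ε (classifier B) :=
    le_iSup_of_le g (le_iSup_of_le hg (le_iSup_of_le hgd le_rfl))
  have hSS : ∀ z, S (S z) = z := fun z => by
    refine Prod.ext rfl ?_
    have : ∀ y : Fin 2, 1 - (1 - y) = y := by decide
    exact this z.2
  have h1 : ∫⁻ z, ℓ z.1 ∂π = ∫⁻ z, ℓ z ∂labelMeasure μ := by
    rw [← hfst, Measure.fst, lintegral_map hℓ measurable_fst]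
  have h2 : ∫⁻ z, ℓ (S z.2) ∂π = ∫⁻ z, ℓ z ∂labelMeasure μ := by
    have e1 : ∫⁻ z, ℓ (S z.2) ∂π = ∫⁻ z, ℓ (S z) ∂π.snd :=
      (lintegral_map (hℓ.comp hS) measurable_snd).symm
    have e2 : ∫⁻ z, ℓ (S z) ∂swapLabels (labelMeasure μ) =
        ∫⁻ z, ℓ (S (S z)) ∂labelMeasure μ := lintegral_map (hℓ.comp hS) hS
    rw [e1, hsnd, e2]
    simp only [hSS]
  have ae1 : ∀ᵐ z ∂π, (∃ b, dist z.1.1 b ≤ ε ∧ classifier B b ≠ z.1.2) → ℓ z.1 = 1 := by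
    rw [← hfst] at hℓ1
    exact ae_of_ae_map measurable_fst.aemeasurable hℓ1
  have ae2 : ∀ᵐ z ∂π, (∃ b, dist (S z.2).1 b ≤ ε ∧ classifier B b ≠ (S z.2).2) →
      ℓ (S z.2) = 1 := by
    have hmap : (π.snd).map S = labelMeasure μ := by
      rw [hsnd, swapLabels, Measure.map_map hS hS]
      have : S ∘ S = id := funext hSS
      change (labelMeasure μ).map (S ∘ S) = _
      rw [this, Measure.map_id]
    rw [← hmap] at hℓ1
    exact ae_of_ae_map measurable_snd.aemeasurable (ae_of_ae_map hS.aemeasurable hℓ1)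
  set C : Set (Datum × Datum) := {z | 2 * ε < dist z.1.1 z.2.1 ∨ z.1.2 ≠ z.2.2} with hC
  have hCm : MeasurableSet C := measurableSet_transportCost ε
  have hpt : ∀ᵐ z ∂π, 1 ≤ ℓ z.1 + ℓ (S z.2) + C.indicator 1 z := by
    filter_upwards [ae1, ae2] with z h1 h2
    by_cases hz : z ∈ C
    · rw [indicator_of_mem hz]; exact le_add_self
    simp only [hC, mem_ofPred_eq, not_or, not_lt, not_not] at hz
    obtain ⟨hdist, hy⟩ := hz
    -- The midpoint is within `ε` of both points, whose true labels `z.1.2` and `1 - z.2.2` differ.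
    by_cases hm : classifier B ((z.1.1 + z.2.1) / 2) = z.1.2
    · have : ℓ (S z.2) = 1 := by
        refine h2 ⟨(z.1.1 + z.2.1) / 2, ?_, ?_⟩
        · simp only [S, Real.dist_eq] at hdist ⊢
          rw [abs_le] at *
          constructor <;> linarith
        · rw [hm, hy]
          have : ∀ y : Fin 2, y ≠ 1 - y := by decide
          exact this _
      rw [this]
      exact le_add_right le_add_self
    · have : ℓ z.1 = 1 := by
        refine h1 ⟨(z.1.1 + z.2.1) / 2, ?_, hm⟩
        simp only [Real.dist_eq] at hdist ⊢
        rw [abs_le] at *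
        constructor <;> linarith
      rw [this]
      exact le_add_right le_self_add
  calc (1 : ℝ≥0∞) = ∫⁻ _, 1 ∂π := by simp
    _ ≤ ∫⁻ z, (ℓ z.1 + ℓ (S z.2) + C.indicator 1 z) ∂π := lintegral_mono_ae hpt
    _ = ∫⁻ z, ℓ z ∂labelMeasure μ + ∫⁻ z, ℓ z ∂labelMeasure μ + π C := by
      have e : ∫⁻ z, (ℓ z.1 + ℓ (S z.2)) ∂π = ∫⁻ z, ℓ z.1 ∂π + ∫⁻ z, ℓ (S z.2) ∂π :=
        lintegral_add_left (hℓ.comp measurable_fst) _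
      rw [lintegral_add_right _ (measurable_one.indicator hCm), e, h1, h2,
        lintegral_indicator_one hCm]
    _ ≤ _ := by
      rw [two_mul]
      gcongr

/-! ### Upper bound of the adversarial risk by the offset sets -/

theorem measurableSet_offsetSet {A : Set ℝ} (hA : MeasurableSet A) (s : ℝ) :
    MeasurableSet (offsetSet A s) := by
  classical
  refine measurableSet_le ?_ measurable_const
  refine Measurable.ite hA ?_ ?_
  · exact (measurable_coe_ennreal_ereal.comp measurable_infEDist).neg
  · exact measurable_coe_ennreal_ereal.comp measurable_infEDist

theorem ereal_coe_ofReal {ε : ℝ} (hε : 0 ≤ ε) : ((ENNReal.ofReal ε : ℝ≥0∞) : EReal) = (ε : EReal) := by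
  rw [EReal.coe_ennreal_ofReal, max_eq_left hε]

theorem mem_offsetSet_of_nonneg {A : Set ℝ} {ε x : ℝ} (hε : 0 ≤ ε) :
    x ∈ offsetSet A ε ↔ x ∈ A ∨ Metric.infEDist x A ≤ ENNReal.ofReal ε := by
  simp only [offsetSet, extSignedDist, mem_ofPred_eq]
  split_ifs with hx
  · simp only [hx, true_or, iff_true]
    exact le_trans (by simpa using EReal.coe_ennreal_nonneg _) (EReal.coe_nonneg.2 hε)
  · rw [← ereal_coe_ofReal hε, EReal.coe_ennreal_le_coe_ennreal_iff]
    simp [hx]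

/-- Positivity matters: `offsetSet A 0` is the closure of `A`, while the right-hand side at `ε = 0`
would be `A`. -/
theorem mem_offsetSet_neg_of_pos {A : Set ℝ} {ε x : ℝ} (hε : 0 < ε) :
    x ∈ offsetSet A (-ε) ↔ x ∈ A ∧ ENNReal.ofReal ε ≤ Metric.infEDist x Aᶜ := by
  simp only [offsetSet, extSignedDist, mem_ofPred_eq]
  split_ifs with hx
  · rw [EReal.coe_neg, EReal.neg_le_neg_iff, ← ereal_coe_ofReal hε.le,
      EReal.coe_ennreal_le_coe_ennreal_iff]
    simp [hx]
  · simp only [hx, false_and, iff_false, not_le]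
    exact lt_of_lt_of_le (by exact_mod_cast (neg_lt_zero.2 hε)) (EReal.coe_ennreal_nonneg _)

/-- Class 0 is misclassified only if it can reach `A`, class 1 only if it can reach the complement.
The second event and the complement of `offsetSet A (-ε)` differ by a distance level set if `ε > 0`,
and by a part of the frontier if `ε = 0`; both are null. -/
theorem robustRisk_le_offsetSet (μ : Fin 2 → Measure ℝ) (hμ : ∀ y, μ y ≪ volume)
    {ε : ℝ} (hε : 0 ≤ ε) {A : Set ℝ} (hA : MeasurableSet A) (hfr : volume (frontier A) = 0) :
    robustRisk (labelMeasure μ) ε (classifier A) ≤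
      μ 0 (offsetSet A ε) + μ 1 (offsetSet A (-ε))ᶜ := by
  refine iSup_le fun g => iSup_le fun hg => iSup_le fun hd => ?_
  have hm : Measurable fun z : Datum => zeroOneLoss (classifier A (g z)) z.2 :=
    measurable_zeroOneLoss ((measurable_classifier hA).comp hg)
  have hle : ∀ (S : Set ℝ) (p y : Fin 2) (x : ℝ), (p ≠ y → x ∈ S) →
      zeroOneLoss p y ≤ S.indicator 1 x := by
    intro S p y x h
    by_cases hp : p = y
    · simp [zeroOneLoss, hp]
    · rw [indicator_of_mem (h hp), zeroOneLoss_self_of_ne hp, Pi.one_apply]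
  have hnear : ∀ (S : Set ℝ) (x : ℝ) (y : Fin 2), g (x, y) ∈ S →
      Metric.infEDist x S ≤ ENNReal.ofReal ε := by
    intro S x y h
    refine (Metric.infEDist_le_edist_of_mem h).trans ?_
    rw [edist_comm, edist_dist]
    exact ENNReal.ofReal_le_ofReal (hd (x, y))
  rw [lintegral_labelMeasure μ hm,
    ← lintegral_indicator_one (measurableSet_offsetSet hA _),
    ← lintegral_indicator_one (measurableSet_offsetSet hA _).compl]
  refine add_le_add (lintegral_mono fun x => hle _ _ _ _ fun h => ?_)
    (lintegral_mono_ae ((hμ 1).ae_le ?_))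
  · have hg : g (x, 0) ∈ A := by
      by_contra h'; simp [classifier, h'] at h
    exact (mem_offsetSet_of_nonneg hε).2 (Or.inr (hnear A x 0 hg))
  · have hnot : ∀ x, classifier A (g (x, 1)) ≠ 1 → g (x, 1) ∉ A := fun x h h' => by
      simp [classifier, h'] at h
    rcases hε.eq_or_lt with rfl | hε
    · filter_upwards [measure_eq_zero_iff_ae_notMem.1 hfr] with x hx
      refine hle _ _ _ _ fun h hxo => hx ?_
      rw [neg_zero, mem_offsetSet_of_nonneg le_rfl, ENNReal.ofReal_zero, nonpos_iff_eq_zero,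
        ← Metric.mem_closure_iff_infEDist_zero] at hxo
      have hxA : x ∉ A := by
        have := hnot x h
        rwa [dist_le_zero.1 (hd (x, 1))] at this
      exact ⟨hxo.resolve_left hxA, fun hi => hxA (interior_subset hi)⟩
    · filter_upwards [measure_eq_zero_iff_ae_notMem.1 (volume_infEDist_eq_ofReal Aᶜ hε)] with x hx
      refine hle _ _ _ _ fun h hxo => hx ?_
      rw [mem_offsetSet_neg_of_pos hε] at hxo
      exact le_antisymm (hnear Aᶜ x 1 (hnot x h)) hxo.2

/-! ### Completing a partial matching of the two classes to a coupling -/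

/-- Finite measures dominated by measures of equal mass extend to a coupling. -/
theorem exists_coupling_ge.{u} {α β : Type u} [MeasurableSpace α] [MeasurableSpace β]
    (μ : Measure α) (ν : Measure β) [IsFiniteMeasure μ] [IsFiniteMeasure ν]
    (hmass : μ univ = ν univ) (τ : Measure (α × β)) [IsFiniteMeasure τ]
    (h₁ : τ.fst ≤ μ) (h₂ : τ.snd ≤ ν) :
    ∃ π : Measure (α × β), π.fst = μ ∧ π.snd = ν ∧ τ ≤ π := by
  set r := μ - τ.fst with hr
  set s := ν - τ.snd with hs
  have hrs : r univ = s univ := by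
    rw [hr, hs, Measure.sub_apply MeasurableSet.univ h₁, Measure.sub_apply MeasurableSet.univ h₂,
      hmass, Measure.fst_univ, Measure.snd_univ]
  have hfin : r univ ≠ ∞ := measure_ne_top _ _
  -- The remainders are coupled by their normalised product. If they vanish, the factor is `∞ * 0 =
  -- 0` and the identity still holds.
  have key : ∀ {γ : Type u} [MeasurableSpace γ] (m : Measure γ), m univ = r univ →
      ((r univ)⁻¹ * r univ) • m = m := by
    intro γ _ m hm
    by_cases h0 : r univ = 0
    · rw [h0, Measure.measure_univ_eq_zero] at hm
      simp [hm]
    · rw [ENNReal.inv_mul_cancel h0 hfin, one_smul]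
  refine ⟨(r univ)⁻¹ • r.prod s + τ, ?_, ?_, Measure.le_add_left le_rfl⟩
  · rw [Measure.fst_add, Measure.fst, Measure.map_smul, Measure.map_fst_prod, smul_smul,
      ← hrs, key r rfl]
    exact Measure.sub_add_cancel_of_le h₁
  · rw [Measure.snd_add, Measure.snd, Measure.map_smul, Measure.map_snd_prod, smul_smul,
      key s hrs.symm]
    exact Measure.sub_add_cancel_of_le h₂

/-- In the swapped measure a point of class 1 carries label 0, so matched points of opposite classes
are paired at zero cost. Each matched pair serves twice, once from class 0 to class 1 and once
backwards, whence the factor 2. -/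
theorem exists_coupling_of_matching (μ : Fin 2 → Measure ℝ) [∀ y, IsFiniteMeasure (μ y)]
    (hmass : labelMeasure μ univ = 1) {ε : ℝ} (σ : Measure (ℝ × ℝ))
    (h₁ : σ.fst ≤ μ 0) (h₂ : σ.snd ≤ μ 1) (hd : ∀ᵐ z ∂σ, dist z.1 z.2 ≤ 2 * ε) :
    ∃ π ∈ couplings (labelMeasure μ) (swapLabels (labelMeasure μ)),
      2 * σ univ + π {z : Datum × Datum | 2 * ε < dist z.1.1 z.2.1 ∨ z.1.2 ≠ z.2.2} ≤ 1 := by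
  have hσ : IsFiniteMeasure σ := ⟨by
    rw [← Measure.fst_univ]; exact (h₁ univ).trans_lt (measure_lt_top _ _)⟩
  let i₀ : ℝ × ℝ → Datum × Datum := fun z => ((z.1, 0), (z.2, 0))
  let i₁ : ℝ × ℝ → Datum × Datum := fun z => ((z.2, 1), (z.1, 1))
  have hi₀ : Measurable i₀ := by fun_prop
  have hi₁ : Measurable i₁ := by fun_prop
  set τ := σ.map i₀ + σ.map i₁ with hτ
  have hfst : τ.fst = labelMeasure ![σ.fst, σ.snd] := by
    rw [hτ, Measure.fst_add, labelMeasure, Fin.sum_univ_two, Measure.fst, Measure.fst,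
      Measure.map_map measurable_fst hi₀, Measure.map_map measurable_fst hi₁]
    simp only [Matrix.cons_val_zero, Matrix.cons_val_one, Measure.fst, Measure.snd]
    rw [Measure.map_map (by fun_prop) measurable_fst, Measure.map_map (by fun_prop) measurable_snd]
    rfl
  have hsnd : τ.snd = labelMeasure ![σ.snd, σ.fst] := by
    rw [hτ, Measure.snd_add, labelMeasure, Fin.sum_univ_two, Measure.snd, Measure.snd,
      Measure.map_map measurable_snd hi₀, Measure.map_map measurable_snd hi₁]
    simp only [Matrix.cons_val_zero, Matrix.cons_val_one, Measure.fst, Measure.snd]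
    rw [Measure.map_map (by fun_prop) measurable_fst, Measure.map_map (by fun_prop) measurable_snd]
    rfl
  have hswap : swapLabels (labelMeasure μ) = labelMeasure (fun y => μ (1 - y)) :=
    swapLabels_labelMeasure μ
  have hmass' : swapLabels (labelMeasure μ) univ = 1 := by
    rw [swapLabels, Measure.map_apply measurable_swapLabel MeasurableSet.univ, preimage_univ, hmass]
  have : IsFiniteMeasure (swapLabels (labelMeasure μ)) := ⟨by rw [hmass']; simp⟩
  obtain ⟨π, hπ₁, hπ₂, hle⟩ := exists_coupling_ge (labelMeasure μ) (swapLabels (labelMeasure μ))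
    (hmass.trans hmass'.symm) τ
    (by
      rw [hfst]
      refine labelMeasure_mono fun y => ?_
      fin_cases y
      exacts [h₁, h₂])
    (by
      rw [hsnd, hswap]
      refine labelMeasure_mono fun y => ?_
      fin_cases y
      exacts [h₂, h₁])
  have hprob : IsProbabilityMeasure π := ⟨by rw [← Measure.fst_univ, hπ₁, hmass]⟩
  refine ⟨π, ⟨hprob, hπ₁, hπ₂⟩, ?_⟩
  have hC := measurableSet_transportCost ε
  set C : Set (Datum × Datum) := {z | 2 * ε < dist z.1.1 z.2.1 ∨ z.1.2 ≠ z.2.2} with hCdef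
  have hτC : τ Cᶜ = 2 * σ univ := by
    have e₀ : σ (i₀ ⁻¹' Cᶜ) = σ univ := by
      refine measure_congr ?_
      filter_upwards [hd] with z hz
      refine propext ⟨fun _ => trivial, fun _ => ?_⟩
      change ¬ (2 * ε < dist z.1 z.2 ∨ _)
      simp only [not_or, not_lt, hz, true_and, not_not]
      rfl
    have e₁ : σ (i₁ ⁻¹' Cᶜ) = σ univ := by
      refine measure_congr ?_
      filter_upwards [hd] with z hz
      refine propext ⟨fun _ => trivial, fun _ => ?_⟩
      change ¬ (2 * ε < dist z.2 z.1 ∨ _)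
      rw [dist_comm]
      simp only [not_or, not_lt, hz, true_and, not_not]
      rfl
    rw [hτ, Measure.add_apply, Measure.map_apply hi₀ hC.compl, Measure.map_apply hi₁ hC.compl,
      e₀, e₁, two_mul]
  calc 2 * σ univ + π C = τ Cᶜ + π C := by rw [hτC]
    _ ≤ π Cᶜ + π C := by gcongr
    _ = 1 := by rw [add_comm, measure_add_measure_compl hC, measure_univ]

/-! ### Measures with a continuous density -/

/-- The measure on the real line with density `f`. -/
def densityMeasure (f : ℝ → ℝ) : Measure ℝ := volume.withDensity (fun x => ENNReal.ofReal (f x))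

theorem densityMeasure_apply {f : ℝ → ℝ} {s : Set ℝ} (hs : MeasurableSet s) :
    densityMeasure f s = ∫⁻ x in s, ENNReal.ofReal (f x) := withDensity_apply _ hs

theorem densityMeasure_Icc {f : ℝ → ℝ} (hf : Continuous f) (h0 : ∀ x, 0 ≤ f x) {a b : ℝ}
    (hab : a ≤ b) : densityMeasure f (Icc a b) = ENNReal.ofReal (∫ x in a..b, f x) := by
  rw [densityMeasure_apply measurableSet_Icc, integral_of_le hab, ← integral_Icc_eq_integral_Ioc,
    ofReal_integral_eq_lintegral_ofReal hf.continuousOn.integrableOn_Icc (ae_of_all _ h0)]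

theorem exists_coupling_densityMeasure {f g : ℝ → ℝ} (hf : Continuous f) (hg : Continuous g)
    (hf0 : ∀ x, 0 ≤ f x) (hg0 : ∀ x, 0 ≤ g x) {q p η : ℝ} (hqp : q ≤ p) (hη : 0 ≤ η)
    (htot : ∫ x in q..p, f x = ∫ x in q..p, g x)
    (h₁ : ∀ x ∈ Icc q p, ∫ t in q..x, g t ≤ ∫ t in q..x, f t)
    (h₂ : ∀ x, q ≤ x → x + η ≤ p → ∫ t in q..x, f t ≤ ∫ t in q..(x + η), g t) :
    ∃ σ : Measure (ℝ × ℝ), σ.fst = (densityMeasure f).restrict (Icc q p) ∧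
      σ.snd = (densityMeasure g).restrict (Icc q p) ∧ ∀ᵐ z ∂σ, dist z.1 z.2 ≤ η := by
  have hIic : ∀ {h : ℝ → ℝ}, Continuous h → (∀ x, 0 ≤ h x) → ∀ x,
      (densityMeasure h).restrict (Icc q p) (Iic x) =
        if x < q then 0 else ENNReal.ofReal (∫ t in q..(min x p), h t) := by
    intro h hh h0 x
    rw [Measure.restrict_apply measurableSet_Iic]
    split_ifs with hx
    · have : Iic x ∩ Icc q p = ∅ := by
        ext y; simp only [mem_inter_iff, mem_Iic, mem_Icc, mem_empty_iff_false, iff_false]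
        rintro ⟨h1, h2, -⟩; linarith
      rw [this, measure_empty]
    · have : Iic x ∩ Icc q p = Icc q (min x p) := by
        ext y; simp only [mem_inter_iff, mem_Iic, mem_Icc, le_min_iff]; tauto
      rw [this, densityMeasure_Icc hh h0 (le_min (not_lt.1 hx) hqp)]
  have huniv : ∀ {h : ℝ → ℝ}, Continuous h → (∀ x, 0 ≤ h x) →
      (densityMeasure h).restrict (Icc q p) univ = ENNReal.ofReal (∫ t in q..p, h t) := by
    intro h hh h0
    rw [Measure.restrict_apply_univ, densityMeasure_Icc hh h0 hqp]
  have : IsFiniteMeasure ((densityMeasure f).restrict (Icc q p)) :=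
    ⟨by rw [huniv hf hf0]; exact ENNReal.ofReal_lt_top⟩
  have : IsFiniteMeasure ((densityMeasure g).restrict (Icc q p)) :=
    ⟨by rw [huniv hg hg0]; exact ENNReal.ofReal_lt_top⟩
  refine exists_monotone_coupling _ _ η (by rw [huniv hf hf0, huniv hg hg0, htot]) ?_ ?_
  · intro x
    rw [hIic hf hf0, hIic hg hg0]
    split_ifs with hx
    · exact le_rfl
    · exact ENNReal.ofReal_le_ofReal (h₁ _ ⟨le_min (not_lt.1 hx) hqp, min_le_right _ _⟩)
  · intro x
    rw [hIic hf hf0, hIic hg hg0]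
    by_cases hx : x < q
    · simp [hx]
    have hx' : ¬ x + η < q := fun h => hx (by linarith)
    rw [if_neg hx, if_neg hx']
    refine ENNReal.ofReal_le_ofReal ?_
    rcases le_total (x + η) p with hp | hp
    · rw [min_eq_left hp, min_eq_left (by linarith)]
      exact h₂ x (not_lt.1 hx) hp
    · rw [min_eq_right hp, ← htot]
      exact integral_mono_interval le_rfl (le_min (not_lt.1 hx) hqp) (min_le_right _ _)
        (ae_of_all _ hf0) (hf.intervalIntegrable _ _)

/-! ### Transversal crossings of two densities -/

/-- The functions `f, g ≥ 0`, with derivatives `f', g'`, cross at `c`, and on the window of radius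
`δ` around `c` every slope of `f` is smaller than every slope of `g`. -/
structure IsUpcrossing (f g f' g' : ℝ → ℝ) (c δ : ℝ) : Prop where
  hasDerivAt_left : ∀ x, HasDerivAt f (f' x) x
  hasDerivAt_right : ∀ x, HasDerivAt g (g' x) x
  left_nonneg : ∀ x, 0 ≤ f x
  right_nonneg : ∀ x, 0 ≤ g x
  pos : 0 < δ
  eq : f c = g c
  slope_lt : ∀ u ∈ Icc (c - δ) (c + δ), ∀ v ∈ Icc (c - δ) (c + δ), f' v < g' u

namespace IsUpcrossing

variable {f g f' g' : ℝ → ℝ} {c δ : ℝ}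

theorem continuous_left (h : IsUpcrossing f g f' g' c δ) : Continuous f :=
  continuous_iff_continuousAt.2 fun x => (h.hasDerivAt_left x).continuousAt

theorem continuous_right (h : IsUpcrossing f g f' g' c δ) : Continuous g :=
  continuous_iff_continuousAt.2 fun x => (h.hasDerivAt_right x).continuousAt

/-- `slope_lt` compares slopes at independent points, so the monotonicity survives different shifts
of the two arguments. The case `s = 2 * ε`, `t = 0` controls the displacement of the coupling. -/
theorem sub_lt_sub (h : IsUpcrossing f g f' g' c δ) {s t x y : ℝ} (hxy : x < y)
    (hs : c - δ ≤ x + s) (hs' : y + s ≤ c + δ) (ht : c - δ ≤ x + t) (ht' : y + t ≤ c + δ) :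
    g (x + s) - f (x + t) < g (y + s) - f (y + t) := by
  have hd : ∀ z, HasDerivAt (fun z => g (z + s) - f (z + t)) (g' (z + s) - f' (z + t)) z := fun z =>
    ((h.hasDerivAt_right (z + s)).comp_add_const z s).sub
      ((h.hasDerivAt_left (z + t)).comp_add_const z t)
  have hm : StrictMonoOn (fun z => g (z + s) - f (z + t)) (Icc x y) := by
    refine strictMonoOn_of_deriv_pos (convex_Icc x y)
      (fun z _ => (hd z).continuousAt.continuousWithinAt) fun z hz => ?_
    rw [interior_Icc] at hz
    rw [(hd z).deriv, sub_pos]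
    exact h.slope_lt _ ⟨by linarith [hz.1], by linarith [hz.2]⟩ _
      ⟨by linarith [hz.1], by linarith [hz.2]⟩
  exact hm ⟨le_rfl, hxy.le⟩ ⟨hxy.le, le_rfl⟩ hxy

theorem sub_le_sub (h : IsUpcrossing f g f' g' c δ) {s t x y : ℝ} (hxy : x ≤ y)
    (hs : c - δ ≤ x + s) (hs' : y + s ≤ c + δ) (ht : c - δ ≤ x + t) (ht' : y + t ≤ c + δ) :
    g (x + s) - f (x + t) ≤ g (y + s) - f (y + t) := by
  rcases hxy.eq_or_lt with rfl | hlt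
  · exact le_rfl
  · exact (h.sub_lt_sub hlt hs hs' ht ht').le

theorem lt_of_gt (h : IsUpcrossing f g f' g' c δ) {x : ℝ} (hx : c < x) (hx' : x ≤ c + δ) :
    f x < g x := by
  have := h.sub_lt_sub (s := 0) (t := 0) hx (by linarith [h.pos]) (by linarith)
    (by linarith [h.pos]) (by linarith)
  simp only [add_zero, h.eq] at this
  linarith

theorem lt_of_lt (h : IsUpcrossing f g f' g' c δ) {x : ℝ} (hx : x < c) (hx' : c - δ ≤ x) :
    g x < f x := by
  have := h.sub_lt_sub (s := 0) (t := 0) hx (by linarith) (by linarith [h.pos])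
    (by linarith) (by linarith [h.pos])
  simp only [add_zero, h.eq] at this
  linarith

theorem le_of_ge (h : IsUpcrossing f g f' g' c δ) {x : ℝ} (hx : c ≤ x) (hx' : x ≤ c + δ) :
    f x ≤ g x := by
  rcases hx.eq_or_lt with rfl | hlt
  · exact h.eq.le
  · exact (h.lt_of_gt hlt hx').le

theorem le_of_le (h : IsUpcrossing f g f' g' c δ) {x : ℝ} (hx : x ≤ c) (hx' : c - δ ≤ x) :
    g x ≤ f x := by
  rcases hx.eq_or_lt with rfl | hlt
  · exact h.eq.ge
  · exact (h.lt_of_lt hlt hx').le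

/-- The mass of `f` to the right of `t - ε` balances the mass of `g` to the right of `t + ε`. -/
theorem exists_right_end (h : IsUpcrossing f g f' g' c δ) {ε t : ℝ} (hε : 0 ≤ ε)
    (ht : t + ε ≤ c + δ) (ht' : c - δ ≤ t + ε)
    (hpos : ∫ x in (t - ε)..(c + δ), f x ≤ ∫ x in (t + ε)..(c + δ), g x) :
    ∃ p, t + ε ≤ p ∧ c ≤ p ∧ p ≤ c + δ ∧ ∫ x in (t - ε)..p, f x = ∫ x in (t + ε)..p, g x := by
  have hf := h.continuous_left
  have hg := h.continuous_right
  have hcont : Continuous fun p => (∫ x in (t + ε)..p, g x) - ∫ x in (t - ε)..p, f x :=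
    (continuous_primitive (fun a b => hg.intervalIntegrable a b) _).sub
      (continuous_primitive (fun a b => hf.intervalIntegrable a b) _)
  have h0 : 0 ≤ ∫ x in (t - ε)..(t + ε), f x :=
    integral_nonneg (by linarith) fun x _ => h.left_nonneg x
  have hadd : ∀ p, (∫ x in (t - ε)..(t + ε), f x) + ∫ x in (t + ε)..p, f x =
      ∫ x in (t - ε)..p, f x := fun p =>
    integral_add_adjacent_intervals (hf.intervalIntegrable _ _) (hf.intervalIntegrable _ _)
  -- Searching to the right of both `t + ε` and `c` keeps them inside the window; at this starting
  -- value the mass of `g` does not exceed that of `f`.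
  have hmax : max (t + ε) c ≤ c + δ := max_le ht (by linarith [h.pos])
  have hlow : (∫ x in (t + ε)..(max (t + ε) c), g x) - ∫ x in (t - ε)..(max (t + ε) c), f x ≤ 0 := by
    rw [← hadd]
    rcases le_total c (t + ε) with hc | hc
    · rw [max_eq_left hc, integral_same, integral_same]; linarith
    · rw [max_eq_right hc]
      have : ∫ x in (t + ε)..c, g x ≤ ∫ x in (t + ε)..c, f x :=
        integral_mono_on hc (hg.intervalIntegrable _ _) (hf.intervalIntegrable _ _)
          fun x hx => h.le_of_le hx.2 (by linarith [hx.1])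
      linarith
  obtain ⟨p, hp, hp0⟩ := intermediate_value_Icc hmax hcont.continuousOn
    (show (0 : ℝ) ∈ Icc _ _ from ⟨hlow, by linarith⟩)
  exact ⟨p, (le_max_left _ _).trans hp.1, (le_max_right _ _).trans hp.1, hp.2, by
    simp only at hp0; linarith⟩

/-- The mass of `f` to the left of `t - ε` balances the mass of `g` to the left of `t + ε`. -/
theorem exists_left_end (h : IsUpcrossing f g f' g' c δ) {ε t : ℝ} (hε : 0 ≤ ε)
    (ht : t - ε ≤ c + δ) (ht' : c - δ ≤ t - ε)
    (hpos : ∫ x in (c - δ)..(t + ε), g x ≤ ∫ x in (c - δ)..(t - ε), f x) :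
    ∃ q, q ≤ t - ε ∧ q ≤ c ∧ c - δ ≤ q ∧ ∫ x in q..(t - ε), f x = ∫ x in q..(t + ε), g x := by
  -- The reflection of the line turns a left end into a right end and exchanges the roles of `f` and
  -- `g`.
  have hr : IsUpcrossing (fun x => g (-x)) (fun x => f (-x)) (fun x => -g' (-x))
      (fun x => -f' (-x)) (-c) δ :=
    { hasDerivAt_left := fun x => by
        convert! (h.hasDerivAt_right (-x)).comp x (hasDerivAt_neg x) using 1; ring
      hasDerivAt_right := fun x => by
        convert! (h.hasDerivAt_left (-x)).comp x (hasDerivAt_neg x) using 1; ring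
      left_nonneg := fun x => h.right_nonneg _
      right_nonneg := fun x => h.left_nonneg _
      pos := h.pos
      eq := by simpa using h.eq.symm
      slope_lt := fun u hu v hv => by
        have := h.slope_lt (-v) ⟨by linarith [hv.2], by linarith [hv.1]⟩ (-u)
          ⟨by linarith [hu.2], by linarith [hu.1]⟩
        linarith }
  obtain ⟨p, hp₁, hp₂, hp₃, hp⟩ := hr.exists_right_end (t := -t) hε (by linarith) (by linarith) (by
    rw [integral_comp_neg, integral_comp_neg]
    convert! hpos using 2 <;> ring)
  refine ⟨-p, by linarith, by linarith, by linarith, ?_⟩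
  rw [integral_comp_neg, integral_comp_neg] at hp
  have e₁ : -(-t - ε) = t + ε := by ring
  have e₂ : -(-t + ε) = t - ε := by ring
  rw [e₁, e₂] at hp
  exact hp.symm

/-- If `g (t + ε) = f (t - ε)`, then on a window on which the masses balance the monotone coupling
of `f` and `g` has displacement at most `2 ε`. -/
theorem exists_coupling (h : IsUpcrossing f g f' g' c δ) {ε t q p : ℝ} (hε : 0 ≤ ε)
    (ht : g (t + ε) = f (t - ε)) (hq₁ : q ≤ t - ε) (hq₂ : q ≤ c) (hq₃ : c - δ ≤ q)
    (hq : ∫ x in q..(t - ε), f x = ∫ x in q..(t + ε), g x)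
    (hp₁ : t + ε ≤ p) (hp₂ : c ≤ p) (hp₃ : p ≤ c + δ)
    (hp : ∫ x in (t - ε)..p, f x = ∫ x in (t + ε)..p, g x) :
    ∃ σ : Measure (ℝ × ℝ), σ.fst = (densityMeasure f).restrict (Icc q p) ∧
      σ.snd = (densityMeasure g).restrict (Icc q p) ∧ ∀ᵐ z ∂σ, dist z.1 z.2 ≤ 2 * ε := by
  have hf := h.continuous_left
  have hg := h.continuous_right
  have if' : ∀ a b, IntervalIntegrable f volume a b := fun a b => hf.intervalIntegrable a b
  have ig' : ∀ a b, IntervalIntegrable g volume a b := fun a b => hg.intervalIntegrable a b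
  have af : ∀ a b d, (∫ x in a..b, f x) + ∫ x in b..d, f x = ∫ x in a..d, f x := fun a b d =>
    integral_add_adjacent_intervals (if' _ _) (if' _ _)
  have ag : ∀ a b d, (∫ x in a..b, g x) + ∫ x in b..d, g x = ∫ x in a..d, g x := fun a b d =>
    integral_add_adjacent_intervals (ig' _ _) (ig' _ _)
  have htot : ∫ x in q..p, f x = ∫ x in q..p, g x := by
    rw [← af q (t - ε) p, ← ag q (t + ε) p, hq, hp]
  refine exists_coupling_densityMeasure hf hg h.left_nonneg h.right_nonneg (hq₂.trans hp₂)
    (by linarith) htot ?_ ?_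
  -- Left of `c` the integrands compare directly; right of `c` the tails do, and the total masses
  -- agree.
  · intro x hx
    rcases le_total x c with hxc | hxc
    · exact integral_mono_on hx.1 (ig' _ _) (if' _ _)
        fun y hy => h.le_of_le (hy.2.trans hxc) (hq₃.trans hy.1)
    · have : ∫ y in x..p, f y ≤ ∫ y in x..p, g y :=
        integral_mono_on hx.2 (if' _ _) (ig' _ _)
          fun y hy => h.le_of_ge (hxc.trans hy.1) (hy.2.trans hp₃)
      linarith [af q x p, ag q x p]
  -- By `hq` there is equality at `x = t - ε`. The difference has derivative `g (x + 2 * ε) - f x`,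
  -- which is increasing and vanishes there by `ht`, so this is its minimum.
  · intro x hqx hxp
    have hshift : ∀ a b, ∫ y in a..b, g (y + 2 * ε) = ∫ y in (a + 2 * ε)..(b + 2 * ε), g y :=
      fun a b => integral_comp_add_right g (2 * ε)
    have igs : ∀ a b, IntervalIntegrable (fun y => g (y + 2 * ε)) volume a b := fun a b =>
      (hg.comp (continuous_add_const (2 * ε))).intervalIntegrable a b
    have e : t - ε + 2 * ε = t + ε := by ring
    rcases le_total x (t - ε) with hx | hx
    · have : ∫ y in x..(t - ε), g (y + 2 * ε) ≤ ∫ y in x..(t - ε), f y := by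
        refine integral_mono_on hx (igs _ _) (if' _ _) fun y hy => ?_
        have := h.sub_le_sub (s := 2 * ε) (t := 0) hy.2 (by linarith [hy.1]) (by linarith)
          (by linarith [hy.1]) (by linarith)
        rw [e, ht, add_zero, add_zero] at this
        linarith
      rw [hshift, e] at this
      linarith [af q x (t - ε), ag q (x + 2 * ε) (t + ε)]
    · have : ∫ y in (t - ε)..x, f y ≤ ∫ y in (t - ε)..x, g (y + 2 * ε) := by
        refine integral_mono_on hx (if' _ _) (igs _ _) fun y hy => ?_
        have := h.sub_le_sub (s := 2 * ε) (t := 0) hy.1 (by linarith) (by linarith [hy.2])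
          (by linarith) (by linarith [hy.2])
        rw [e, ht, add_zero, add_zero] at this
        linarith
      rw [hshift, e] at this
      linarith [af q (t - ε) x, ag q (t + ε) (x + 2 * ε)]

end IsUpcrossing

namespace IsUpcrossing

variable {f g f' g' : ℝ → ℝ} {c δ : ℝ}

/-! ### The evolution of an endpoint -/

theorem hasDerivAt_balance (h : IsUpcrossing f g f' g' c δ) {y : ℝ → ℝ} {y' s : ℝ} {S : Set ℝ}
    (hy : HasDerivWithinAt y y' S s) :
    HasDerivWithinAt (fun s => g (y s + s) - f (y s - s))
      (y' * (g' (y s + s) - f' (y s - s)) + (g' (y s + s) + f' (y s - s))) S s := by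
  have h1 : HasDerivWithinAt (fun s => g (y s + s)) (g' (y s + s) * (y' + 1)) S s :=
    (h.hasDerivAt_right (y s + s)).comp_hasDerivWithinAt (h := fun s => y s + s) s
      (hy.add (hasDerivWithinAt_id s S))
  have h2 : HasDerivWithinAt (fun s => f (y s - s)) (f' (y s - s) * (y' - 1)) S s :=
    (h.hasDerivAt_left (y s - s)).comp_hasDerivWithinAt (h := fun s => y s - s) s
      (hy.sub (hasDerivWithinAt_id s S))
  convert! h1.sub h2 using 1
  ring

/-- A solution of the evolution equation conserves `g (y + ε) - f (y - ε)`. -/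
theorem balance_of_solution (h : IsUpcrossing f g f' g' c δ) {T : ℝ} {y : ℝ → ℝ} (hy0 : y 0 = c)
    (hy : ∀ ε ∈ Icc 0 T, g' (y ε + ε) - f' (y ε - ε) ≠ 0 ∧ HasDerivWithinAt y
      (-((g' (y ε + ε) + f' (y ε - ε)) / (g' (y ε + ε) - f' (y ε - ε)))) (Icc 0 T) ε) :
    ∀ ε ∈ Icc 0 T, g (y ε + ε) = f (y ε - ε) := by
  have hd : ∀ ε ∈ Icc 0 T, HasDerivWithinAt (fun s => g (y s + s) - f (y s - s)) 0 (Icc 0 T) ε := by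
    intro ε hε
    have := h.hasDerivAt_balance (hy ε hε).2
    rwa [neg_mul, div_mul_cancel₀ _ (hy ε hε).1, neg_add_cancel] at this
  intro ε hε
  have := constant_of_has_deriv_right_zero (fun x hx => (hd x hx).continuousWithinAt)
    (fun x hx => (hd x ⟨hx.1, hx.2.le⟩).mono_of_mem_nhdsWithin (Icc_mem_nhdsGE_of_mem hx)) ε hε
  simp only [hy0, add_zero, sub_zero, h.eq, sub_self] at this
  linarith

/-- The implicit function theorem solves `g (t + ε) - f (t - ε) = 0` for `t` near `(0, c)`, the
`t`-derivative there being `g' c - f' c > 0`. Differentiating the identity gives the evolution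
equation. -/
theorem exists_local_solution (h : IsUpcrossing f g f' g' c δ) (hf : ContDiff ℝ 1 f)
    (hg : ContDiff ℝ 1 g) : ∃ y : ℝ → ℝ, y 0 = c ∧ ∀ᶠ ε in 𝓝 (0 : ℝ),
      g' (y ε + ε) - f' (y ε - ε) ≠ 0 ∧ HasDerivAt y
        (-((g' (y ε + ε) + f' (y ε - ε)) / (g' (y ε + ε) - f' (y ε - ε)))) ε := by
  let F : ℝ × ℝ → ℝ := fun u => g (u.2 + u.1) - f (u.2 - u.1)
  have hF : ContDiffAt ℝ 1 F ((0 : ℝ), c) := by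
    have : ContDiff ℝ 1 F := by fun_prop
    exact this.contDiffAt
  have hD : 0 < g' c - f' c := sub_pos.2 (h.slope_lt c
    ⟨by linarith [h.pos], by linarith [h.pos]⟩ c ⟨by linarith [h.pos], by linarith [h.pos]⟩)
  have hinv : (fderiv ℝ F ((0 : ℝ), c) ∘L .inr ℝ ℝ ℝ).IsInvertible := by
    have hfd : HasFDerivAt F (fderiv ℝ F (0, c)) ((0 : ℝ), c) :=
      (hF.differentiableAt one_ne_zero).hasFDerivAt
    have h1 : HasDerivAt (fun t : ℝ => F (0, t)) (fderiv ℝ F (0, c) (0, 1)) c :=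
      hfd.comp_hasDerivAt (x := c) (f := fun t : ℝ => ((0 : ℝ), t))
        ((hasDerivAt_const c (0 : ℝ)).prodMk (hasDerivAt_id c))
    have h2 : HasDerivAt (fun t : ℝ => F (0, t)) (g' c - f' c) c := by
      simp only [F, add_zero, sub_zero]
      exact (h.hasDerivAt_right c).sub (h.hasDerivAt_left c)
    refine ⟨ContinuousLinearEquiv.unitsEquivAut ℝ (Units.mk0 (g' c - f' c) hD.ne'), ?_⟩
    ext
    simp [h1.unique h2]
  set y := hF.implicitFunction one_ne_zero hinv with hydef
  have hy0 : y 0 = c := hF.implicitFunction_apply_self one_ne_zero hinv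
  have hyC : ContDiffAt ℝ 1 y 0 := hF.contDiffAt_implicitFunction one_ne_zero hinv
  have hycont : ContinuousAt y 0 := hyC.continuousAt
  refine ⟨y, hy0, ?_⟩
  have hplus : ∀ᶠ s in 𝓝 (0 : ℝ), y s + s ∈ Icc (c - δ) (c + δ) := by
    have : ContinuousAt (fun s => y s + s) 0 := hycont.add continuousAt_id
    refine this (Icc_mem_nhds ?_ ?_) <;> simp [hy0, h.pos]
  have hminus : ∀ᶠ s in 𝓝 (0 : ℝ), y s - s ∈ Icc (c - δ) (c + δ) := by
    have : ContinuousAt (fun s => y s - s) 0 := hycont.sub continuousAt_id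
    refine this (Icc_mem_nhds ?_ ?_) <;> simp [hy0, h.pos]
  have hbal : ∀ᶠ s in 𝓝 (0 : ℝ), F (s, y s) = F (0, c) :=
    hF.eventually_apply_implicitFunction one_ne_zero hinv
  filter_upwards [hplus, hminus, hbal.eventually_nhds, hyC.eventually (by simp)]
    with s h1 h2 h3 h4
  have hDs : g' (y s + s) - f' (y s - s) ≠ 0 := (sub_pos.2 (h.slope_lt _ h1 _ h2)).ne'
  have hys := (h4.differentiableAt one_ne_zero).hasDerivAt
  refine ⟨hDs, ?_⟩
  have hder := (h.hasDerivAt_balance hys.hasDerivWithinAt (S := univ)).hasDerivAt univ_mem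
  have hzero : HasDerivAt (fun s => g (y s + s) - f (y s - s)) 0 s :=
    (hasDerivAt_const s (F (0, c))).congr_of_eventuallyEq h3
  have := hder.unique hzero
  have e : -((g' (y s + s) + f' (y s - s)) / (g' (y s + s) - f' (y s - s))) = deriv y s := by
    rw [← neg_div, div_eq_iff hDs]
    linarith
  rwa [e]

/-! ### Windows around a moving endpoint -/

/-- At `ε = 0`, `t = c` both inequalities are strict, and they persist by continuity. They are what
`exists_right_end` and `exists_left_end` need; `2 * r ≤ δ` keeps `t ± ε` within `δ` of `c`. -/
theorem exists_radius (h : IsUpcrossing f g f' g' c δ) : ∃ r, 0 < r ∧ 2 * r ≤ δ ∧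
    ∀ ε t, |ε| ≤ r → |t - c| ≤ r →
      ∫ x in (t - ε)..(c + δ), f x ≤ ∫ x in (t + ε)..(c + δ), g x ∧
      ∫ x in (c - δ)..(t + ε), g x ≤ ∫ x in (c - δ)..(t - ε), f x := by
  have hf := h.continuous_left
  have hg := h.continuous_right
  have cf : ∀ a, Continuous fun b => ∫ x in a..b, f x := fun a =>
    continuous_primitive (fun a b => hf.intervalIntegrable a b) a
  have cg : ∀ a, Continuous fun b => ∫ x in a..b, g x := fun a =>
    continuous_primitive (fun a b => hg.intervalIntegrable a b) a
  have ev₁ : ∀ᶠ u : ℝ × ℝ in 𝓝 (0, c),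
      ∫ x in (c + δ)..(u.2 + u.1), g x < ∫ x in (c + δ)..(u.2 - u.1), f x := by
    refine ContinuousAt.eventually_lt
      ((cg (c + δ)).comp (continuous_snd.add continuous_fst)).continuousAt
      ((cf (c + δ)).comp (continuous_snd.sub continuous_fst)).continuousAt ?_
    simp only [add_zero, sub_zero]
    rw [integral_symm, integral_symm c, neg_lt_neg_iff]
    exact integral_lt_integral_of_continuousOn_of_le_of_exists_lt (by linarith [h.pos])
      hf.continuousOn hg.continuousOn (fun x hx => h.le_of_ge hx.1.le hx.2)
      ⟨c + δ, ⟨by linarith [h.pos], le_rfl⟩, h.lt_of_gt (by linarith [h.pos]) le_rfl⟩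
  have ev₂ : ∀ᶠ u : ℝ × ℝ in 𝓝 (0, c),
      ∫ x in (c - δ)..(u.2 + u.1), g x < ∫ x in (c - δ)..(u.2 - u.1), f x := by
    refine ContinuousAt.eventually_lt
      ((cg (c - δ)).comp (continuous_snd.add continuous_fst)).continuousAt
      ((cf (c - δ)).comp (continuous_snd.sub continuous_fst)).continuousAt ?_
    simp only [add_zero, sub_zero]
    exact integral_lt_integral_of_continuousOn_of_le_of_exists_lt (by linarith [h.pos])
      hg.continuousOn hf.continuousOn (fun x hx => h.le_of_le hx.2 hx.1.le)
      ⟨c - δ, ⟨le_rfl, by linarith [h.pos]⟩, h.lt_of_lt (by linarith [h.pos]) le_rfl⟩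
  obtain ⟨R, hR, hball⟩ := Metric.eventually_nhds_iff.1 (ev₁.and ev₂)
  refine ⟨min (R / 2) (δ / 2), lt_min (by linarith) (by linarith [h.pos]),
    by linarith [min_le_right (R / 2) (δ / 2)], fun ε t hε ht => ?_⟩
  have hR2 := min_le_left (R / 2) (δ / 2)
  obtain ⟨b₁, b₂⟩ := hball (y := (ε, t)) (by
    rw [Prod.dist_eq, Real.dist_eq, Real.dist_eq, sub_zero]
    exact max_lt (by linarith) (by linarith))
  refine ⟨?_, b₂.le⟩
  rw [integral_symm, integral_symm (c + δ), neg_le_neg_iff]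
  exact b₁.le

end IsUpcrossing

/-- The set `J` is a neighbourhood of an endpoint which has moved from `c₀` to `c`, and `σ` is a
coupling of the restrictions to `J` of the densities `f` and `g` with displacement at most `2 ε`. -/
structure IsWindow (f g : ℝ → ℝ) (δ ε : ℝ) (c₀ c : EReal) (J : Set ℝ)
    (σ : Measure (ℝ × ℝ)) : Prop where
  measurableSet : MeasurableSet J
  near : ∀ x ∈ J, ∃ r : ℝ, c₀ = r ∧ |x - r| ≤ δ
  -- Off `J`, each point is on the same side of `c`, at distance more than `ε`, as of `c₀`.
  lt_of_le : ∀ x ∉ J, c ≤ ((x + ε : ℝ) : EReal) → c₀ < (x : EReal)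
  lt_of_ge : ∀ x ∉ J, c₀ ≤ (x : EReal) → c < ((x - ε : ℝ) : EReal)
  fst_eq : σ.fst = (densityMeasure f).restrict J
  snd_eq : σ.snd = (densityMeasure g).restrict J
  dist_le : ∀ᵐ z ∂σ, dist z.1 z.2 ≤ 2 * ε
  -- The mass of `f` that can be moved to the right of `c`, plus the mass of `g` that can be moved
  -- to its left, is covered by the mass matched in `J`.
  measure_le : densityMeasure f (J ∩ {x | c ≤ ((x + ε : ℝ) : EReal)}) +
    densityMeasure g (J ∩ {x | ((x - ε : ℝ) : EReal) ≤ c}) ≤ densityMeasure f J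

/-- An infinite endpoint stays put and needs no window; the empty one lets it be treated like a
finite endpoint. -/
theorem isWindow_empty (f g : ℝ → ℝ) (δ ε : ℝ) {c : EReal} (hc : c = ⊥ ∨ c = ⊤) :
    IsWindow f g δ ε c c ∅ 0 where
  measurableSet := MeasurableSet.empty
  near := by simp
  lt_of_le := fun x _ h => by
    rcases hc with rfl | rfl
    · exact EReal.bot_lt_coe x
    · exact absurd h (not_le.2 (EReal.coe_lt_top _))
  lt_of_ge := fun x _ h => by
    rcases hc with rfl | rfl
    · exact EReal.bot_lt_coe _
    · exact absurd h (not_le.2 (EReal.coe_lt_top _))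
  fst_eq := by simp
  snd_eq := by simp
  dist_le := by simp
  measure_le := by simp

namespace IsUpcrossing

variable {f g f' g' : ℝ → ℝ} {c δ : ℝ}

/-- `measure_le` holds with equality: `g` on `[q, t + ε]` weighs as much as `f` on `[q, t - ε]`,
which complements `f` on `[t - ε, p]`. -/
theorem exists_isWindow (h : IsUpcrossing f g f' g' c δ) {r : ℝ} (hr : 2 * r ≤ δ)
    (hint : ∀ ε t, |ε| ≤ r → |t - c| ≤ r →
      ∫ x in (t - ε)..(c + δ), f x ≤ ∫ x in (t + ε)..(c + δ), g x ∧
      ∫ x in (c - δ)..(t + ε), g x ≤ ∫ x in (c - δ)..(t - ε), f x)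
    {ε t : ℝ} (hε : 0 ≤ ε) (hεr : ε ≤ r) (htr : |t - c| ≤ r) (ht : g (t + ε) = f (t - ε)) :
    ∃ J σ, IsWindow f g δ ε c t J σ := by
  obtain ⟨i₁, i₂⟩ := hint ε t (by rwa [abs_of_nonneg hε]) htr
  obtain ⟨ht₁, ht₂⟩ := abs_le.1 htr
  obtain ⟨p, hp₁, hp₂, hp₃, hp⟩ := h.exists_right_end hε (by linarith) (by linarith) i₁
  obtain ⟨q, hq₁, hq₂, hq₃, hq⟩ := h.exists_left_end hε (by linarith) (by linarith) i₂
  obtain ⟨σ, hσ₁, hσ₂, hσ⟩ := h.exists_coupling hε ht hq₁ hq₂ hq₃ hq hp₁ hp₂ hp₃ hp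
  refine ⟨Icc q p, σ, measurableSet_Icc, fun x hx => ⟨c, rfl, ?_⟩, fun x hx hle => ?_,
    fun x hx hle => ?_, hσ₁, hσ₂, hσ, ?_⟩
  · rw [abs_le]; constructor <;> linarith [hx.1, hx.2]
  · rw [EReal.coe_le_coe_iff] at hle
    rw [EReal.coe_lt_coe_iff]
    by_contra! hxc
    exact hx ⟨by linarith, by linarith⟩
  · rw [EReal.coe_le_coe_iff] at hle
    rw [EReal.coe_lt_coe_iff]
    by_contra! hxt
    exact hx ⟨by linarith, by linarith⟩
  · have hf := h.continuous_left
    have hg := h.continuous_right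
    have e₁ : Icc q p ∩ {x | (t : EReal) ≤ ((x + ε : ℝ) : EReal)} = Icc (t - ε) p := by
      ext x
      simp only [mem_inter_iff, mem_Icc, mem_ofPred_eq, EReal.coe_le_coe_iff]
      constructor
      · rintro ⟨⟨h1, h2⟩, h3⟩; exact ⟨by linarith, h2⟩
      · rintro ⟨h1, h2⟩; exact ⟨⟨by linarith, h2⟩, by linarith⟩
    have e₂ : Icc q p ∩ {x | ((x - ε : ℝ) : EReal) ≤ (t : EReal)} = Icc q (t + ε) := by
      ext x
      simp only [mem_inter_iff, mem_Icc, mem_ofPred_eq, EReal.coe_le_coe_iff]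
      constructor
      · rintro ⟨⟨h1, h2⟩, h3⟩; exact ⟨h1, by linarith⟩
      · rintro ⟨h1, h2⟩; exact ⟨⟨h1, by linarith⟩, by linarith⟩
    rw [e₁, e₂, densityMeasure_Icc hf h.left_nonneg (by linarith),
      densityMeasure_Icc hg h.right_nonneg (by linarith),
      densityMeasure_Icc hf h.left_nonneg (by linarith), ← hq, ← ENNReal.ofReal_add
        (integral_nonneg (by linarith) fun x _ => h.left_nonneg x)
        (integral_nonneg (by linarith) fun x _ => h.left_nonneg x), add_comm,
      integral_add_adjacent_intervals (hf.intervalIntegrable _ _) (hf.intervalIntegrable _ _)]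

/-- For short times, the evolution equation of an endpoint has a solution, and each solution has
windows. -/
theorem eventually_isWindow (h : IsUpcrossing f g f' g' c δ) (hf : ContDiff ℝ 1 f)
    (hg : ContDiff ℝ 1 g) : ∀ᶠ T in 𝓝[>] (0 : ℝ),
      (∃ y : ℝ → ℝ, y 0 = c ∧ ∀ ε ∈ Icc 0 T, g' (y ε + ε) - f' (y ε - ε) ≠ 0 ∧
        HasDerivWithinAt y (-((g' (y ε + ε) + f' (y ε - ε)) / (g' (y ε + ε) - f' (y ε - ε))))
          (Icc 0 T) ε) ∧
      ∀ y : ℝ → ℝ, y 0 = c → (∀ ε ∈ Icc 0 T, g' (y ε + ε) - f' (y ε - ε) ≠ 0 ∧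
        HasDerivWithinAt y (-((g' (y ε + ε) + f' (y ε - ε)) / (g' (y ε + ε) - f' (y ε - ε))))
          (Icc 0 T) ε) → ∀ ε ∈ Icc 0 T, ∃ J σ, IsWindow f g δ ε c (y ε) J σ := by
  obtain ⟨φ, hφ0, hφ⟩ := h.exists_local_solution hf hg
  obtain ⟨R, hR, hball⟩ := Metric.eventually_nhds_iff.1 hφ
  obtain ⟨r, hr0, hr, hint⟩ := h.exists_radius
  have cf := h.continuous_left
  have cg := h.continuous_right
  -- For small `ε` the conserved balance fails at `c - r` and at `c + r`. These are barriers that a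
  -- continuous solution starting at `c` cannot cross.
  have ev₁ : ∀ᶠ ε in 𝓝 (0 : ℝ), g (c - r + ε) < f (c - r - ε) := by
    refine ContinuousAt.eventually_lt (by fun_prop) (by fun_prop) ?_
    simpa using h.lt_of_lt (by linarith) (by linarith)
  have ev₂ : ∀ᶠ ε in 𝓝 (0 : ℝ), f (c + r - ε) < g (c + r + ε) := by
    refine ContinuousAt.eventually_lt (by fun_prop) (by fun_prop) ?_
    simpa using h.lt_of_gt (by linarith) (by linarith)
  obtain ⟨R', hR', hball'⟩ := Metric.eventually_nhds_iff.1 (ev₁.and ev₂)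
  have hsmall : Ioo 0 (min (min R R') r) ∈ 𝓝[>] (0 : ℝ) :=
    Ioo_mem_nhdsGT (lt_min (lt_min hR hR') hr0)
  filter_upwards [hsmall] with T hT
  have hTR : T < R := hT.2.trans_le ((min_le_left _ _).trans (min_le_left _ _))
  have hTR' : T < R' := hT.2.trans_le ((min_le_left _ _).trans (min_le_right _ _))
  have hTr : T < r := hT.2.trans_le (min_le_right _ _)
  have hd : ∀ ε ∈ Icc 0 T, dist ε 0 ≤ T := fun ε hε => by
    rw [Real.dist_eq, sub_zero, abs_of_nonneg hε.1]; exact hε.2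
  refine ⟨⟨φ, hφ0, fun ε hε => ?_⟩, fun y hy0 hy ε hε => ?_⟩
  · obtain ⟨h1, h2⟩ := hball ((hd ε hε).trans_lt hTR)
    exact ⟨h1, h2.hasDerivWithinAt⟩
  · have hbal := h.balance_of_solution hy0 hy
    have hcont : ContinuousOn y (Icc 0 T) := fun s hs => (hy s hs).2.continuousWithinAt
    have hsub : Icc 0 ε ⊆ Icc 0 T := Icc_subset_Icc_right hε.2
    have hupper : y ε ≤ c + r := by
      by_contra! hlt
      obtain ⟨s, hs, hys⟩ := intermediate_value_Icc hε.1 (hcont.mono hsub)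
        (show c + r ∈ Icc (y 0) (y ε) from ⟨by linarith, hlt.le⟩)
      have h1 := hbal s (hsub hs)
      have h2 := (hball' ((hd s (hsub hs)).trans_lt hTR')).2
      rw [hys] at h1
      exact h2.ne' h1
    have hlower : c - r ≤ y ε := by
      by_contra! hlt
      obtain ⟨s, hs, hys⟩ := intermediate_value_Icc' hε.1 (hcont.mono hsub)
        (show c - r ∈ Icc (y ε) (y 0) from ⟨hlt.le, by linarith⟩)
      have h1 := hbal s (hsub hs)
      have h2 := (hball' ((hd s (hsub hs)).trans_lt hTR')).1
      rw [hys] at h1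
      exact h2.ne h1
    exact h.exists_isWindow hr hint hε.1 (hε.2.trans hTr.le)
      (abs_le.2 ⟨by linarith, by linarith⟩) (hbal ε hε)

end IsUpcrossing

theorem exists_isUpcrossing {f g f' g' : ℝ → ℝ} (hf : ∀ x, HasDerivAt f (f' x) x)
    (hg : ∀ x, HasDerivAt g (g' x) x) (hf' : Continuous f') (hg' : Continuous g')
    (hf0 : ∀ x, 0 ≤ f x) (hg0 : ∀ x, 0 ≤ g x) {c : ℝ} (hc : f c = g c) (hlt : f' c < g' c)
    {δ : ℝ} (hδ : 0 < δ) : ∃ δ' ≤ δ, IsUpcrossing f g f' g' c δ' := by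
  have hev : ∀ᶠ u : ℝ × ℝ in 𝓝 (c, c), f' u.2 < g' u.1 :=
    ContinuousAt.eventually_lt (by fun_prop) (by fun_prop) hlt
  obtain ⟨R, hR, hball⟩ := Metric.eventually_nhds_iff.1 hev
  refine ⟨min δ (R / 2), min_le_left _ _, hf, hg, hf0, hg0, lt_min hδ (by linarith), hc,
    fun u hu v hv => hball (y := (u, v)) ?_⟩
  have := min_le_right δ (R / 2)
  rw [Prod.dist_eq, Real.dist_eq, Real.dist_eq]
  refine max_lt ?_ ?_
  · rw [abs_lt]; constructor <;> linarith [hu.1, hu.2]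
  · rw [abs_lt]; constructor <;> linarith [hv.1, hv.2]

theorem IsWindow.mono {f g : ℝ → ℝ} {δ δ' ε : ℝ} {c₀ c : EReal} {J : Set ℝ}
    {σ : Measure (ℝ × ℝ)} (h : IsWindow f g δ ε c₀ c J σ) (hδ : δ ≤ δ') :
    IsWindow f g δ' ε c₀ c J σ :=
  { h with near := fun x hx => (h.near x hx).imp fun _ hr => ⟨hr.1, hr.2.trans hδ⟩ }

/-- Stated for all small `T`, so that finitely many endpoints can share one horizon. Every solution
gets its windows, so uniqueness of solutions plays no role. -/
theorem eventually_endpointEvolves {f g f' g' : ℝ → ℝ} (hf : ∀ x, HasDerivAt f (f' x) x)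
    (hg : ∀ x, HasDerivAt g (g' x) x) (hf1 : ContDiff ℝ 1 f) (hg1 : ContDiff ℝ 1 g)
    (hf' : Continuous f') (hg' : Continuous g')
    (hf0 : ∀ x, 0 ≤ f x) (hg0 : ∀ x, 0 ≤ g x) {c₀ : EReal}
    (hc : ∀ r : ℝ, c₀ = r → f r = g r ∧ f' r < g' r) {δ : ℝ} (hδ : 0 < δ) :
    ∀ᶠ T in 𝓝[>] (0 : ℝ),
      (∃ c, EndpointEvolves (fun ε t => g' (t + ε) + f' (t - ε))
        (fun ε t => g' (t + ε) - f' (t - ε)) T c₀ c) ∧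
      ∀ c, EndpointEvolves (fun ε t => g' (t + ε) + f' (t - ε))
        (fun ε t => g' (t + ε) - f' (t - ε)) T c₀ c →
          ∀ ε ∈ Icc 0 T, ∃ J σ, IsWindow f g δ ε c₀ (c ε) J σ := by
  by_cases hinf : c₀ = ⊥ ∨ c₀ = ⊤
  · refine Eventually.of_forall fun T => ⟨⟨fun _ => c₀, Or.inl ⟨hinf, fun _ _ => rfl⟩⟩, ?_⟩
    rintro c (⟨-, hc⟩ | ⟨y, hy, -⟩) ε hε
    · exact ⟨∅, 0, by rw [hc ε hε]; exact isWindow_empty f g δ ε hinf⟩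
    · rcases hinf with h | h <;> simp [hy] at h
  · push Not at hinf
    lift c₀ to ℝ using ⟨hinf.2, hinf.1⟩
    obtain ⟨he, hlt⟩ := hc c₀ rfl
    obtain ⟨δ', hδ', hup⟩ := exists_isUpcrossing hf hg hf' hg' hf0 hg0 he hlt hδ
    filter_upwards [hup.eventually_isWindow hf1 hg1] with T hT
    obtain ⟨⟨y, hy0, hy⟩, hall⟩ := hT
    refine ⟨⟨fun ε => (y ε : EReal), Or.inr ⟨y, by rw [hy0], fun _ _ => rfl, hy⟩⟩, ?_⟩
    rintro c (⟨h, -⟩ | ⟨z, hz0, hcz, hz⟩) ε hε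
    · exact absurd h (by simp)
    · obtain ⟨J, σ, hJ⟩ := hall z (by exact_mod_cast hz0.symm) hz ε hε
      exact ⟨J, σ, by rw [hcz ε hε]; exact hJ.mono hδ'⟩

/-! ### Open sets of the real line with finitely many boundary points -/

/-- An open set with finite frontier and without isolated holes is a finite union of open intervals
with pairwise distinct endpoints, listed in increasing order. -/
theorem exists_intervalUnion_eq {U : Set ℝ} (hU : IsOpen U) (hfin : (frontier U).Finite)
    (hole : ∀ r ∉ U, ∀ η > 0, Ioo (r - η) r ⊆ U → Ioo r (r + η) ⊆ U → False) :
    ∃ (K : ℕ) (a b : Fin K → EReal), (∀ i, a i < b i) ∧ (∀ i j, i < j → b i < a j) ∧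
      intervalUnion a b = U ∧
      (∀ i (r : ℝ), a i = r → r ∉ U ∧ ∃ η > 0, Ioo r (r + η) ⊆ U) ∧
      (∀ i (r : ℝ), b i = r → r ∉ U ∧ ∃ η > 0, Ioo (r - η) r ⊆ U) := by
  -- `L` consists of the left endpoints of the components of `U`, and `B a` is the right endpoint of
  -- the component starting at `a`.
  let S : EReal → Set EReal := fun a => {b | ∀ x : ℝ, a < x → (x : EReal) < b → x ∈ U}
  let L : Set EReal := {a | (∀ r : ℝ, a = r → r ∉ U) ∧ ∃ b ∈ S a, a < b}
  let B : EReal → EReal := fun a => sSup (S a)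
  have hnhd : ∀ r ∈ U, ∃ η > 0, Ioo (r - η) (r + η) ⊆ U := fun r hr => by
    obtain ⟨η, hη, h⟩ := Metric.isOpen_iff.1 hU r hr
    exact ⟨η, hη, by rwa [Real.ball_eq_Ioo] at h⟩
  have hBS : ∀ a, B a ∈ S a := fun a x hax hxb => by
    obtain ⟨b, hb, hxb'⟩ := lt_sSup_iff.1 hxb
    exact hb x hax hxb'
  have hlt : ∀ a ∈ L, a < B a := by
    rintro a ⟨-, b, hb, hab⟩
    exact hab.trans_le (le_sSup hb)
  have hright : ∀ a ∈ L, ∀ r : ℝ, a = r → ∃ η > 0, Ioo r (r + η) ⊆ U := by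
    rintro a ha r rfl
    obtain ⟨s, hs₁, hs₂⟩ := EReal.lt_iff_exists_real_btwn.1 (hlt _ ha)
    refine ⟨s - r, sub_pos.2 (EReal.coe_lt_coe_iff.1 hs₁), fun x hx => ?_⟩
    refine hBS _ x (EReal.coe_lt_coe_iff.2 hx.1) (lt_trans (EReal.coe_lt_coe_iff.2 ?_) hs₂)
    linarith [hx.2]
  have hleft : ∀ a ∈ L, ∀ r : ℝ, B a = r → ∃ η > 0, Ioo (r - η) r ⊆ U := by
    intro a ha r hr
    have := hlt a ha
    rw [hr] at this
    obtain ⟨s, hs₁, hs₂⟩ := EReal.lt_iff_exists_real_btwn.1 this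
    refine ⟨r - s, sub_pos.2 (EReal.coe_lt_coe_iff.1 hs₂), fun x hx => ?_⟩
    refine hBS a x (hs₁.trans (EReal.coe_lt_coe_iff.2 ?_)) (hr ▸ EReal.coe_lt_coe_iff.2 hx.2)
    linarith [hx.1]
  have hBnot : ∀ a ∈ L, ∀ r : ℝ, B a = r → r ∉ U := by
    intro a ha r hr hrU
    obtain ⟨η, hη, h⟩ := hnhd r hrU
    have hmem : ((r + η : ℝ) : EReal) ∈ S a := fun x hax hx => by
      rw [EReal.coe_lt_coe_iff] at hx
      by_cases hxr : x < r
      · exact hBS a x hax (hr ▸ EReal.coe_lt_coe_iff.2 hxr)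
      · exact h ⟨by linarith, hx⟩
    have : ((r + η : ℝ) : EReal) ≤ r := hr ▸ le_sSup hmem
    rw [EReal.coe_le_coe_iff] at this
    linarith
  have hLfin : L.Finite := by
    refine ((finite_singleton (⊥ : EReal)).union (hfin.image ((↑) : ℝ → EReal))).subset ?_
    intro a ha
    induction a with
    | bot => exact Or.inl rfl
    | top => exact absurd (hlt _ ha) not_top_lt
    | coe r =>
      refine Or.inr ⟨r, ?_, rfl⟩
      rw [hU.frontier_eq]
      refine ⟨?_, ha.1 r rfl⟩
      obtain ⟨η, hη, h⟩ := hright _ ha r rfl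
      refine closure_mono h ?_
      rw [closure_Ioo (by linarith)]
      exact ⟨le_rfl, by linarith⟩
  have hcover : ∀ x ∈ U, ∃ a ∈ L, a < x ∧ (x : EReal) < B a := by
    intro x hx
    obtain ⟨η, hη, hηU⟩ := hnhd x hx
    -- The component of `x` starts at the infimum of the `a` with `(a, x] ⊆ U`; were the infimum in
    -- `U`, openness would allow a smaller `a`.
    let S' : Set EReal := {a | ∀ y : ℝ, a < y → y ≤ x → y ∈ U}
    have hinf : sInf S' ∈ S' := fun y hy hyx => by
      obtain ⟨a, ha, hay⟩ := sInf_lt_iff.1 hy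
      exact ha y hay hyx
    have hlow : ∀ r ∈ U, ∀ η > 0, Ioo (r - η) (r + η) ⊆ U →
        (((r : ℝ) : EReal) ∈ S' ∨ r = x) → ((r - η : ℝ) : EReal) ∈ S' := by
      intro r _ η hη h hr y hy hyx
      rw [EReal.coe_lt_coe_iff] at hy
      rcases lt_or_ge y (r + η) with hyr | hyr
      · exact h ⟨hy, hyr⟩
      · rcases hr with hr | rfl
        · exact hr y (EReal.coe_lt_coe_iff.2 (by linarith)) hyx
        · linarith
    have hax : sInf S' < x :=
      (sInf_le (hlow x hx η hη hηU (Or.inr rfl))).trans_lt (EReal.coe_lt_coe_iff.2 (by linarith))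
    have hS : ((x + η : ℝ) : EReal) ∈ S (sInf S') := fun y hy hyx => by
      rw [EReal.coe_lt_coe_iff] at hyx
      rcases le_or_gt y x with h | h
      · exact hinf y hy h
      · exact hηU ⟨by linarith, hyx⟩
    have hxη : (x : EReal) < ((x + η : ℝ) : EReal) := EReal.coe_lt_coe_iff.2 (by linarith)
    refine ⟨sInf S', ⟨fun r hr hrU => ?_, _, hS, hax.trans hxη⟩, hax, hxη.trans_le (le_sSup hS)⟩
    obtain ⟨η', hη', h'⟩ := hnhd r hrU
    have := sInf_le (hlow r hrU η' hη' h' (Or.inl (hr ▸ hinf)))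
    rw [hr, EReal.coe_le_coe_iff] at this
    linarith
  let e := hLfin.toFinset.orderEmbOfFin rfl
  have he : ∀ i, e i ∈ L := fun i =>
    hLfin.mem_toFinset.1 (Finset.orderEmbOfFin_mem _ _ i)
  refine ⟨hLfin.toFinset.card, e, fun i => B (e i), fun i => hlt _ (he i), ?_, ?_, ?_, ?_⟩
  · intro i j hij
    have haa : e i < e j := e.strictMono hij
    have hbot : e j ≠ ⊥ := (bot_le.trans_lt haa).ne'
    have htop : e j ≠ ⊤ := ((hlt _ (he j)).trans_le le_top).ne
    obtain ⟨r, hr⟩ : ∃ r : ℝ, e j = r := ⟨(e j).toReal, (EReal.coe_toReal htop hbot).symm⟩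
    have hrU := (he j).1 r hr
    refine lt_of_le_of_ne ?_ ?_
    · by_contra! hlt'
      exact hrU (hBS (e i) r (hr ▸ haa) (hr ▸ hlt'))
    · intro heq
      obtain ⟨η₁, hη₁, h₁⟩ := hleft _ (he i) r (heq.trans hr)
      obtain ⟨η₂, hη₂, h₂⟩ := hright _ (he j) r hr
      refine hole r hrU (min η₁ η₂) (lt_min hη₁ hη₂) ?_ ?_
      · exact (Ioo_subset_Ioo_left (by linarith [min_le_left η₁ η₂])).trans h₁
      · exact (Ioo_subset_Ioo_right (by linarith [min_le_right η₁ η₂])).trans h₂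
  · ext x
    constructor
    · rintro ⟨i, hi₁, hi₂⟩
      exact hBS _ x hi₁ hi₂
    · intro hx
      obtain ⟨a, ha, h₁, h₂⟩ := hcover x hx
      have : a ∈ range e := by
        rw [Finset.range_orderEmbOfFin]
        simpa using ha
      obtain ⟨i, rfl⟩ := this
      exact ⟨i, h₁, h₂⟩
  · exact fun i r hr => ⟨(he i).1 r hr, hright _ (he i) r hr⟩
  · exact fun i r hr => ⟨hBnot _ (he i) r hr, hleft _ (he i) r hr⟩

theorem nonneg_of_hasDerivAt_of_right {h : ℝ → ℝ} {h' r η : ℝ} (hd : HasDerivAt h h' r)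
    (hr : h r = 0) (hη : 0 < η) (hpos : ∀ x ∈ Ioo r (r + η), 0 ≤ h x) : 0 ≤ h' := by
  have ht := (hasDerivAt_iff_tendsto_slope.1 hd).mono_left (nhdsGT_le_nhdsNE r)
  refine ge_of_tendsto ht ?_
  filter_upwards [Ioo_mem_nhdsGT (show r < r + η by linarith)] with x hx
  rw [slope_def_field, hr, sub_zero]
  exact div_nonneg (hpos x hx) (sub_pos.2 hx.1).le

theorem nonpos_of_hasDerivAt_of_left {h : ℝ → ℝ} {h' r η : ℝ} (hd : HasDerivAt h h' r)
    (hr : h r = 0) (hη : 0 < η) (hpos : ∀ x ∈ Ioo (r - η) r, 0 ≤ h x) : h' ≤ 0 := by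
  have ht := (hasDerivAt_iff_tendsto_slope.1 hd).mono_left (nhdsLT_le_nhdsNE r)
  refine le_of_tendsto ht ?_
  filter_upwards [Ioo_mem_nhdsLT (show r - η < r by linarith)] with x hx
  rw [slope_def_field, hr, sub_zero]
  exact div_nonpos_of_nonneg_of_nonpos (hpos x hx) (sub_neg.2 hx.2).le

/-- The interior of a Bayes set, for densities that cross transversally at the boundary of the set,
is a finite union of intervals whose endpoints are transversal crossings. -/
theorem exists_isBoundary {f g f' g' : ℝ → ℝ} (hf : ∀ x, HasDerivAt f (f' x) x)
    (hg : ∀ x, HasDerivAt g (g' x) x) {A : Set ℝ} (hin : ∀ x ∈ A, f x ≤ g x)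
    (hout : ∀ x ∉ A, g x ≤ f x) (hfin : {x ∈ frontier A | f x = g x}.Finite)
    (hnd : ∀ x ∈ frontier A, f x = g x → f' x ≠ g' x) :
    (∀ x ∉ interior A, g x ≤ f x) ∧
    ∃ (K : ℕ) (a b : Fin K → EReal), IsBoundary A a b ∧
      (∀ i (r : ℝ), a i = r → f r = g r ∧ f' r < g' r) ∧
      (∀ i (r : ℝ), b i = r → g r = f r ∧ g' r < f' r) := by
  have cf : Continuous f := continuous_iff_continuousAt.2 fun x => (hf x).continuousAt
  have cg : Continuous g := continuous_iff_continuousAt.2 fun x => (hg x).continuousAt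
  have hcl : ∀ x ∈ closure A, f x ≤ g x := fun x hx =>
    closure_minimal (t := {x | f x ≤ g x}) hin (isClosed_le cf cg) hx
  have hcl' : ∀ x ∉ interior A, g x ≤ f x := fun x hx => by
    rw [← mem_compl_iff, ← closure_compl] at hx
    exact closure_minimal (t := {x | g x ≤ f x}) hout (isClosed_le cg cf) hx
  have heq : ∀ x ∈ frontier A, f x = g x := fun x hx => le_antisymm (hcl x hx.1) (hcl' x hx.2)
  have hfin' : (frontier (interior A)).Finite :=
    hfin.subset fun x hx => ⟨frontier_interior_subset hx, heq x (frontier_interior_subset hx)⟩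
  have hsub : ∀ x ∈ interior A, 0 ≤ g x - f x := fun x hx =>
    sub_nonneg.2 (hin x (interior_subset hx))
  have hd : ∀ x, HasDerivAt (fun x => g x - f x) (g' x - f' x) x := fun x => (hg x).sub (hf x)
  have hfrR : ∀ r ∉ interior A, ∀ η > 0, Ioo r (r + η) ⊆ interior A → r ∈ frontier A := by
    intro r hr η hη h
    refine ⟨closure_mono (h.trans interior_subset) ?_, hr⟩
    rw [closure_Ioo (by linarith)]
    exact ⟨le_rfl, by linarith⟩
  have hfrL : ∀ r ∉ interior A, ∀ η > 0, Ioo (r - η) r ⊆ interior A → r ∈ frontier A := by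
    intro r hr η hη h
    refine ⟨closure_mono (h.trans interior_subset) ?_, hr⟩
    rw [closure_Ioo (by linarith)]
    exact ⟨by linarith, le_rfl⟩
  have hR : ∀ r ∉ interior A, ∀ η > 0, Ioo r (r + η) ⊆ interior A → f r = g r ∧ f' r < g' r := by
    intro r hr η hη h
    have hfr := hfrR r hr η hη h
    have he := heq r hfr
    have := nonneg_of_hasDerivAt_of_right (hd r) (by linarith) hη fun x hx => hsub x (h hx)
    exact ⟨he, lt_of_le_of_ne (by linarith) (hnd r hfr he)⟩
  have hL : ∀ r ∉ interior A, ∀ η > 0, Ioo (r - η) r ⊆ interior A → g r = f r ∧ g' r < f' r := by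
    intro r hr η hη h
    have hfr := hfrL r hr η hη h
    have he := heq r hfr
    have := nonpos_of_hasDerivAt_of_left (hd r) (by linarith) hη fun x hx => hsub x (h hx)
    exact ⟨he.symm, lt_of_le_of_ne (by linarith) (hnd r hfr he).symm⟩
  -- An isolated hole would be a crossing in both directions, with `g' < f'` and `f' < g'` at once.
  obtain ⟨K, a, b, h₁, h₂, h₃, ha, hb⟩ := exists_intervalUnion_eq isOpen_interior hfin'
    fun r hr η hη hl hr' => lt_asymm (hL r hr η hη hl).2 (hR r hr η hη hr').2
  refine ⟨hcl', K, a, b, ⟨h₁, h₂, h₃⟩, fun i r hr => ?_, fun i r hr => ?_⟩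
  · obtain ⟨hn, η, hη, h⟩ := ha i r hr
    exact hR r hn η hη h
  · obtain ⟨hn, η, hη, h⟩ := hb i r hr
    exact hL r hn η hη h

/-! ### Gluing the windows to a matching of the two classes -/

theorem sum_restrict_add_restrict_compl {α ι : Type*} [MeasurableSpace α] [Fintype ι]
    (μ : Measure α) {J : ι → Set α} (hJ : ∀ k, MeasurableSet (J k))
    (hdisj : Pairwise fun k l => Disjoint (J k) (J l)) :
    ∑ k, μ.restrict (J k) + μ.restrict (⋃ k, J k)ᶜ = μ := by
  rw [← Measure.sum_fintype, ← Measure.restrict_iUnion hdisj hJ,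
    Measure.restrict_add_restrict_compl (MeasurableSet.iUnion hJ)]

theorem fst_finset_sum {ι : Type*} [Fintype ι] (σ : ι → Measure (ℝ × ℝ)) :
    (∑ k, σ k).fst = ∑ k, (σ k).fst := by
  rw [← Measure.sum_fintype, Measure.fst_sum, Measure.sum_fintype]

theorem snd_finset_sum {ι : Type*} [Fintype ι] (σ : ι → Measure (ℝ × ℝ)) :
    (∑ k, σ k).snd = ∑ k, (σ k).snd := by
  rw [← Measure.sum_fintype, Measure.snd_sum, Measure.sum_fintype]

/-- Couplings on finitely many disjoint windows, together with the diagonal coupling elsewhere,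
give a matching which is at least as large as `densityMeasure f P + densityMeasure g Q`. -/
theorem exists_matching {ι : Type*} [Fintype ι] {f g : ℝ → ℝ} (hf : Continuous f)
    {ε : ℝ} (hε : 0 ≤ ε) {J : ι → Set ℝ} (hJ : ∀ k, MeasurableSet (J k))
    (hdisj : Pairwise fun k l => Disjoint (J k) (J l)) (σ : ι → Measure (ℝ × ℝ))
    (h₁ : ∀ k, (σ k).fst = (densityMeasure f).restrict (J k))
    (h₂ : ∀ k, (σ k).snd = (densityMeasure g).restrict (J k))
    (hd : ∀ k, ∀ᵐ z ∂σ k, dist z.1 z.2 ≤ 2 * ε)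
    {P Q : Set ℝ} (hP : MeasurableSet P) (hQ : MeasurableSet Q)
    (hin : ∀ k, densityMeasure f (J k ∩ P) + densityMeasure g (J k ∩ Q) ≤ densityMeasure f (J k))
    (hout : ∀ x ∉ ⋃ k, J k, (x ∉ Q ∧ f x ≤ g x) ∨ (x ∉ P ∧ g x ≤ f x)) :
    ∃ τ : Measure (ℝ × ℝ), τ.fst ≤ densityMeasure f ∧ τ.snd ≤ densityMeasure g ∧
      (∀ᵐ z ∂τ, dist z.1 z.2 ≤ 2 * ε) ∧
      densityMeasure f P + densityMeasure g Q ≤ τ univ := by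
  set O : Set ℝ := (⋃ k, J k)ᶜ with hO
  have hOm : MeasurableSet O := (MeasurableSet.iUnion hJ).compl
  -- Off the windows nothing moves, and the diagonal can match exactly the smaller density.
  set m := (densityMeasure fun x => min (f x) (g x)).restrict O with hm
  have hdiag : Measurable fun x : ℝ => (x, x) := by fun_prop
  have hmf : m ≤ (densityMeasure f).restrict O := Measure.restrict_mono le_rfl
    (withDensity_mono (ae_of_all _ fun x => ENNReal.ofReal_le_ofReal (min_le_left _ _)))
  have hmg : m ≤ (densityMeasure g).restrict O := Measure.restrict_mono le_rfl
    (withDensity_mono (ae_of_all _ fun x => ENNReal.ofReal_le_ofReal (min_le_right _ _)))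
  have efst : (m.map fun x => (x, x)).fst = m := by
    rw [Measure.fst, Measure.map_map measurable_fst hdiag]; exact Measure.map_id
  have esnd : (m.map fun x => (x, x)).snd = m := by
    rw [Measure.snd, Measure.map_map measurable_snd hdiag]; exact Measure.map_id
  refine ⟨∑ k, σ k + m.map fun x => (x, x), ?_, ?_, ?_, ?_⟩
  · rw [Measure.fst_add, fst_finset_sum, efst]
    simp only [h₁]
    refine (add_le_add_right hmf _).trans (sum_restrict_add_restrict_compl _ hJ hdisj).le
  · rw [Measure.snd_add, snd_finset_sum, esnd]
    simp only [h₂]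
    refine (add_le_add_right hmg _).trans (sum_restrict_add_restrict_compl _ hJ hdisj).le
  · rw [ae_add_measure_iff, ← Measure.sum_fintype, Measure.ae_sum_iff]
    refine ⟨hd, ?_⟩
    rw [ae_map_iff hdiag.aemeasurable (measurableSet_le (by fun_prop) (by fun_prop))]
    refine ae_of_all _ fun x => ?_
    simp only [dist_self]
    linarith
  · have hsplit : ∀ (h : ℝ → ℝ) {S : Set ℝ}, MeasurableSet S → densityMeasure h S =
        ∑ k, densityMeasure h (J k ∩ S) + densityMeasure h (O ∩ S) := by
      intro h S hS
      conv_lhs => rw [← sum_restrict_add_restrict_compl (densityMeasure h) hJ hdisj]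
      rw [Measure.add_apply, Measure.finsetSum_apply, Measure.restrict_apply hS, inter_comm S]
      congr 1
      refine Finset.sum_congr rfl fun k _ => ?_
      rw [Measure.restrict_apply hS, inter_comm S]
    have hτ : (∑ k, σ k + m.map fun x => (x, x)) univ = ∑ k, densityMeasure f (J k) + m univ := by
      rw [← Measure.fst_univ, Measure.fst_add, fst_finset_sum, efst, Measure.add_apply,
        Measure.finsetSum_apply]
      simp only [h₁, Measure.restrict_apply_univ]
    -- By `hout`, at each point of `O` only the smaller of the two densities can contribute.
    have hOPQ : densityMeasure f (O ∩ P) + densityMeasure g (O ∩ Q) ≤ m univ := by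
      rw [hm, Measure.restrict_apply_univ, densityMeasure_apply (hOm.inter hP),
        densityMeasure_apply (hOm.inter hQ), densityMeasure_apply hOm,
        ← lintegral_indicator (hOm.inter hP), ← lintegral_indicator (hOm.inter hQ),
        ← lintegral_indicator hOm, ← lintegral_add_left
          ((hf.measurable.ennreal_ofReal).indicator (hOm.inter hP))]
      refine lintegral_mono fun x => ?_
      by_cases hx : x ∈ O
      · rcases hout x hx with ⟨hxQ, hle⟩ | ⟨hxP, hle⟩
        · rw [indicator_of_notMem (fun h : x ∈ O ∩ Q => hxQ h.2), add_zero, indicator_of_mem hx,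
            min_eq_left hle]
          exact indicator_le_self' (fun _ _ => zero_le) x
        · rw [indicator_of_notMem (fun h : x ∈ O ∩ P => hxP h.2), zero_add, indicator_of_mem hx,
            min_eq_right hle]
          exact indicator_le_self' (fun _ _ => zero_le) x
      · rw [indicator_of_notMem (fun h : x ∈ O ∩ P => hx h.1),
          indicator_of_notMem (fun h : x ∈ O ∩ Q => hx h.1), add_zero]
        exact zero_le
    rw [hsplit f hP, hsplit g hQ, hτ, add_add_add_comm, ← Finset.sum_add_distrib]
    exact add_le_add (Finset.sum_le_sum fun k _ => hin k) hOPQ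

/-! ### Separation of the endpoints -/

/-- The real points among `u` and `v` keep their `δ`-neighbourhoods at distance more than `δ` from
the other one. -/
def Separated (δ : ℝ) (u v : EReal) : Prop :=
  (∀ r x : ℝ, u = r → |x - r| ≤ δ → ((x + δ : ℝ) : EReal) < v) ∧
  (∀ r x : ℝ, v = r → |x - r| ≤ δ → u < ((x - δ : ℝ) : EReal))

theorem eventually_separated {u v : EReal} (h : u < v) :
    ∀ᶠ δ in 𝓝[>] (0 : ℝ), Separated δ u v := by
  induction u with
  | top => exact absurd h not_top_lt
  | bot =>
    exact Eventually.of_forall fun δ =>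
      ⟨fun r x hr => absurd hr (by simp), fun r x _ _ => EReal.bot_lt_coe _⟩
  | coe p =>
    induction v with
    | bot => exact absurd h not_lt_bot
    | top =>
      exact Eventually.of_forall fun δ =>
        ⟨fun r x _ _ => EReal.coe_lt_top _, fun r x hr => absurd hr (by simp)⟩
    | coe q =>
      have hpq : p < q := EReal.coe_lt_coe_iff.1 h
      filter_upwards [Ioo_mem_nhdsGT (show 0 < (q - p) / 2 by linarith)] with δ hδ
      refine ⟨fun r x hr hx => ?_, fun r x hr hx => ?_⟩
      · rw [EReal.coe_eq_coe_iff] at hr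
        rw [EReal.coe_lt_coe_iff]
        linarith [(abs_le.1 hx).2, hδ.2]
      · rw [EReal.coe_eq_coe_iff] at hr
        rw [EReal.coe_lt_coe_iff]
        linarith [(abs_le.1 hx).1, hδ.2]

namespace IsWindow

variable {f g : ℝ → ℝ} {δ ε : ℝ} {c₀ c : EReal} {J : Set ℝ} {σ : Measure (ℝ × ℝ)}

/-- A point more than `δ` away from an endpoint does not notice that the endpoint has moved. Hence
within a window only the window's own endpoint matters. -/
theorem lt_of_add_lt (h : IsWindow f g δ ε c₀ c J σ) (hδ : 0 < δ) {x : ℝ}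
    (hx : ((x + δ : ℝ) : EReal) < c₀) : ((x + ε : ℝ) : EReal) < c := by
  by_contra! hle
  have hxJ : x ∉ J := fun hxJ => by
    obtain ⟨r, rfl, hr⟩ := h.near x hxJ
    rw [EReal.coe_lt_coe_iff] at hx
    linarith [(abs_le.1 hr).1]
  have h1 := (h.lt_of_le x hxJ hle).trans (lt_trans (EReal.coe_lt_coe_iff.2 (by linarith)) hx)
  exact lt_irrefl _ h1

theorem lt_of_lt_sub (h : IsWindow f g δ ε c₀ c J σ) (hδ : 0 < δ) {x : ℝ}
    (hx : c₀ < ((x - δ : ℝ) : EReal)) : c < ((x - ε : ℝ) : EReal) := by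
  have hxJ : x ∉ J := fun hxJ => by
    obtain ⟨r, rfl, hr⟩ := h.near x hxJ
    rw [EReal.coe_lt_coe_iff] at hx
    linarith [(abs_le.1 hr).2]
  exact h.lt_of_ge x hxJ (hx.trans (EReal.coe_lt_coe_iff.2 (by linarith))).le

theorem add_lt_of_mem (h : IsWindow f g δ ε c₀ c J σ) {v : EReal} (hs : Separated δ c₀ v) {x : ℝ}
    (hx : x ∈ J) : ((x + δ : ℝ) : EReal) < v := by
  obtain ⟨r, hr, hxr⟩ := h.near x hx
  exact hs.1 r x hr hxr

theorem lt_sub_of_mem (h : IsWindow f g δ ε c₀ c J σ) {u : EReal} (hs : Separated δ u c₀) {x : ℝ}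
    (hx : x ∈ J) : u < ((x - δ : ℝ) : EReal) := by
  obtain ⟨r, hr, hxr⟩ := h.near x hx
  exact hs.2 r x hr hxr

theorem disjoint_of_separated {f' g' : ℝ → ℝ} {d₀ d : EReal} {J' : Set ℝ} {σ' : Measure (ℝ × ℝ)}
    (h : IsWindow f g δ ε c₀ c J σ) (h' : IsWindow f' g' δ ε d₀ d J' σ')
    (hs : Separated δ c₀ d₀) : Disjoint J J' := by
  refine Set.disjoint_left.2 fun x hx hx' => ?_
  have h1 := h.add_lt_of_mem hs hx
  obtain ⟨r, rfl, hr⟩ := h'.near x hx'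
  rw [EReal.coe_lt_coe_iff] at h1
  linarith [(abs_le.1 hr).1]

end IsWindow

/-- The points within `ε` of some interval `[a i, b i]`. -/
def outerSet {K : ℕ} (a b : Fin K → EReal) (ε : ℝ) : Set ℝ :=
  {x | ∃ i, a i ≤ ((x + ε : ℝ) : EReal) ∧ ((x - ε : ℝ) : EReal) ≤ b i}

/-- The points that are not inside some interval `(a i, b i)` at distance more than `ε` from its
endpoints. -/
def innerCompl {K : ℕ} (a b : Fin K → EReal) (ε : ℝ) : Set ℝ :=
  {x | ∀ i, ¬ (a i < ((x - ε : ℝ) : EReal) ∧ ((x + ε : ℝ) : EReal) < b i)}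

theorem measurableSet_outerSet {K : ℕ} (a b : Fin K → EReal) (ε : ℝ) :
    MeasurableSet (outerSet a b ε) := by
  have : outerSet a b ε = ⋃ i, {x : ℝ | a i ≤ ((x + ε : ℝ) : EReal)} ∩
      {x : ℝ | ((x - ε : ℝ) : EReal) ≤ b i} := by
    ext x; simp [outerSet]
  rw [this]
  refine MeasurableSet.iUnion fun i => MeasurableSet.inter ?_ ?_
  · exact measurableSet_le measurable_const (measurable_coe_real_ereal.comp (measurable_add_const ε))
  · exact measurableSet_le (measurable_coe_real_ereal.comp (measurable_sub_const ε)) measurable_const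

theorem measurableSet_innerCompl {K : ℕ} (a b : Fin K → EReal) (ε : ℝ) :
    MeasurableSet (innerCompl a b ε) := by
  have : innerCompl a b ε = ⋂ i, ({x : ℝ | a i < ((x - ε : ℝ) : EReal)} ∩
      {x : ℝ | ((x + ε : ℝ) : EReal) < b i})ᶜ := by
    ext x; simp [innerCompl]
  rw [this]
  refine MeasurableSet.iInter fun i => (MeasurableSet.inter ?_ ?_).compl
  · exact measurableSet_lt measurable_const (measurable_coe_real_ereal.comp (measurable_sub_const ε))
  · exact measurableSet_lt (measurable_coe_real_ereal.comp (measurable_add_const ε)) measurable_const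

/-- Windows around well separated endpoints produce a matching of the two classes. -/
theorem exists_matching_of_isWindow {f g : ℝ → ℝ} (hf : Continuous f)
    {K : ℕ} {a₀ b₀ a b : Fin K → EReal} {δ ε : ℝ} (hδ : 0 < δ) (hε : 0 ≤ ε)
    (hU : ∀ x ∈ intervalUnion a₀ b₀, f x ≤ g x) (hU' : ∀ x ∉ intervalUnion a₀ b₀, g x ≤ f x)
    (sab : ∀ i, Separated δ (a₀ i) (b₀ i)) (sba : ∀ i j, i < j → Separated δ (b₀ i) (a₀ j))
    (saa : ∀ i j, i < j → Separated δ (a₀ i) (a₀ j))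
    (sbb : ∀ i j, i < j → Separated δ (b₀ i) (b₀ j))
    (sab' : ∀ i j, i < j → Separated δ (a₀ i) (b₀ j))
    {Ja Jb : Fin K → Set ℝ} {σa σb : Fin K → Measure (ℝ × ℝ)}
    (ha : ∀ i, IsWindow f g δ ε (a₀ i) (a i) (Ja i) (σa i))
    (hb : ∀ i, IsWindow g f δ ε (b₀ i) (b i) (Jb i) (σb i)) :
    ∃ τ : Measure (ℝ × ℝ), τ.fst ≤ densityMeasure f ∧ τ.snd ≤ densityMeasure g ∧
      (∀ᵐ z ∂τ, dist z.1 z.2 ≤ 2 * ε) ∧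
      densityMeasure f (outerSet a b ε) + densityMeasure g (innerCompl a b ε) ≤ τ univ := by
  let J : Fin K ⊕ Fin K → Set ℝ := Sum.elim Ja Jb
  let σ : Fin K ⊕ Fin K → Measure (ℝ × ℝ) := Sum.elim σa fun i => (σb i).map Prod.swap
  have hswap : ∀ i, ((σb i).map Prod.swap).fst = (densityMeasure f).restrict (Jb i) := fun i => by
    rw [← (hb i).snd_eq, Measure.fst, Measure.map_map measurable_fst measurable_swap]; rfl
  have hswap' : ∀ i, ((σb i).map Prod.swap).snd = (densityMeasure g).restrict (Jb i) := fun i => by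
    rw [← (hb i).fst_eq, Measure.snd, Measure.map_map measurable_snd measurable_swap]; rfl
  have dab : ∀ i j, Disjoint (Ja i) (Jb j) := fun i j => by
    rcases lt_trichotomy i j with h | rfl | h
    · exact (ha i).disjoint_of_separated (hb j) (sab' i j h)
    · exact (ha i).disjoint_of_separated (hb i) (sab i)
    · exact ((hb j).disjoint_of_separated (ha i) (sba j i h)).symm
  refine exists_matching hf hε (J := J) ?_ ?_ σ ?_ ?_ ?_ (measurableSet_outerSet a b ε)
    (measurableSet_innerCompl a b ε) ?_ ?_
  · rintro (i | i)
    exacts [(ha i).measurableSet, (hb i).measurableSet]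
  · rintro (i | i) (j | j) hij
    · rcases lt_or_gt_of_ne (fun h => hij (by rw [h]) : i ≠ j) with h | h
      · exact (ha i).disjoint_of_separated (ha j) (saa i j h)
      · exact ((ha j).disjoint_of_separated (ha i) (saa j i h)).symm
    · exact dab i j
    · exact (dab j i).symm
    · rcases lt_or_gt_of_ne (fun h => hij (by rw [h]) : i ≠ j) with h | h
      · exact (hb i).disjoint_of_separated (hb j) (sbb i j h)
      · exact ((hb j).disjoint_of_separated (hb i) (sbb j i h)).symm
  · rintro (i | i)
    exacts [(ha i).fst_eq, hswap i]
  · rintro (i | i)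
    exacts [(ha i).snd_eq, hswap' i]
  · rintro (i | i)
    · exact (ha i).dist_le
    · change ∀ᵐ z ∂(σb i).map Prod.swap, dist z.1 z.2 ≤ 2 * ε
      rw [ae_map_iff measurable_swap.aemeasurable (measurableSet_le (by fun_prop) (by fun_prop))]
      filter_upwards [(hb i).dist_le] with z hz
      rwa [Prod.fst_swap, Prod.snd_swap, dist_comm]
  · rintro (i | i)
    · refine le_trans ?_ (ha i).measure_le
      refine add_le_add (measure_mono fun x hx => ⟨hx.1, ?_⟩)
        (measure_mono fun x hx => ⟨hx.1, ?_⟩)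
      -- Only `j = i` is possible: for `j > i` the left end of interval `j` is out of reach of `x`,
      -- for `j < i` its right end is.
      · obtain ⟨j, hj₁, hj₂⟩ := hx.2
        rcases lt_trichotomy i j with h | rfl | h
        · exact absurd ((ha j).lt_of_add_lt hδ ((ha i).add_lt_of_mem (saa i j h) hx.1))
            (not_lt.2 hj₁)
        · exact hj₁
        · exact absurd ((hb j).lt_of_lt_sub hδ ((ha i).lt_sub_of_mem (sba j i h) hx.1))
            (not_lt.2 hj₂)
      · refine not_lt.1 fun h => hx.2 i ⟨h, ?_⟩
        exact (hb i).lt_of_add_lt hδ ((ha i).add_lt_of_mem (sab i) hx.1)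
    -- At a right endpoint `measure_le` bounds by the mass of `g`; the coupling forces `f` and `g`
    -- to have equal mass on the window.
    · have hmass : densityMeasure f (Jb i) = densityMeasure g (Jb i) := by
        rw [← Measure.restrict_apply_univ, ← (hb i).snd_eq, Measure.snd_univ, ← Measure.fst_univ,
          (hb i).fst_eq, Measure.restrict_apply_univ]
      change _ ≤ densityMeasure f (Jb i)
      rw [add_comm, hmass]
      refine le_trans ?_ (hb i).measure_le
      refine add_le_add (measure_mono fun x hx => ⟨hx.1, ?_⟩)
        (measure_mono fun x hx => ⟨hx.1, ?_⟩)
      · refine not_lt.1 fun h => hx.2 i ⟨?_, h⟩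
        exact (ha i).lt_of_lt_sub hδ ((hb i).lt_sub_of_mem (sab i) hx.1)
      · obtain ⟨j, hj₁, hj₂⟩ := hx.2
        rcases lt_trichotomy i j with h | rfl | h
        · exact absurd ((ha j).lt_of_add_lt hδ ((hb i).add_lt_of_mem (sba i j h) hx.1))
            (not_lt.2 hj₁)
        · exact hj₂
        · exact absurd ((hb j).lt_of_lt_sub hδ ((hb i).lt_sub_of_mem (sbb j i h) hx.1))
            (not_lt.2 hj₂)
  · intro x hx
    have hxa : ∀ i, x ∉ Ja i := fun i h => hx (mem_iUnion.2 ⟨Sum.inl i, h⟩)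
    have hxb : ∀ i, x ∉ Jb i := fun i h => hx (mem_iUnion.2 ⟨Sum.inr i, h⟩)
    -- Off the windows the original side of each point persists with margin `ε`, so the Bayes
    -- inequality selects the smaller density.
    by_cases hxU : x ∈ intervalUnion a₀ b₀
    · refine Or.inl ⟨fun hxQ => ?_, hU x hxU⟩
      obtain ⟨i, hi₁, hi₂⟩ := hxU
      refine hxQ i ⟨(ha i).lt_of_ge x (hxa i) hi₁.le, ?_⟩
      by_contra! hle
      exact lt_asymm hi₂ ((hb i).lt_of_le x (hxb i) hle)
    · refine Or.inr ⟨?_, hU' x hxU⟩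
      rintro ⟨i, hi₁, hi₂⟩
      refine hxU ⟨i, (ha i).lt_of_le x (hxa i) hi₁, ?_⟩
      by_contra! hle
      exact absurd ((hb i).lt_of_ge x (hxb i) hle) (not_lt.2 hi₂)

/-! ### Offset sets of finite unions of intervals -/

theorem isOpen_intervalUnion {K : ℕ} (a b : Fin K → EReal) : IsOpen (intervalUnion a b) := by
  have : intervalUnion a b = ⋃ i, {x : ℝ | a i < x} ∩ {x : ℝ | (x : EReal) < b i} := by
    ext x; simp [intervalUnion]
  rw [this]
  exact isOpen_iUnion fun i => (isOpen_lt continuous_const continuous_coe_real_ereal).inter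
    (isOpen_lt continuous_coe_real_ereal continuous_const)

/-- Convex sets have null frontier, and the frontier of a finite union lies in the union of the
frontiers. No ordering of the endpoints is needed. -/
theorem volume_frontier_intervalUnion {K : ℕ} (a b : Fin K → EReal) :
    volume (frontier (intervalUnion a b)) = 0 := by
  have hU : intervalUnion a b = ⋃ i, {x : ℝ | a i < x ∧ (x : EReal) < b i} := by
    ext x; simp [intervalUnion]
  have hconv : ∀ i, Convex ℝ {x : ℝ | a i < x ∧ (x : EReal) < b i} := fun i => by
    refine OrdConnected.convex ⟨fun x hx y hy z hz => ⟨?_, ?_⟩⟩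
    · exact hx.1.trans_le (EReal.coe_le_coe_iff.2 hz.1)
    · exact lt_of_le_of_lt (EReal.coe_le_coe_iff.2 hz.2) hy.2
  refine measure_mono_null (t := ⋃ i, frontier {x : ℝ | a i < x ∧ (x : EReal) < b i}) ?_
    (measure_iUnion_null fun i => (hconv i).addHaar_frontier volume)
  rintro x ⟨hx₁, hx₂⟩
  rw [hU, closure_iUnion_of_finite] at hx₁
  obtain ⟨i, hi⟩ := mem_iUnion.1 hx₁
  exact mem_iUnion.2 ⟨i, hi, fun h => hx₂ (interior_mono (fun y hy => ⟨i, hy⟩ :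
    {x : ℝ | a i < x ∧ (x : EReal) < b i} ⊆ intervalUnion a b) h)⟩

theorem offsetSet_subset_outerSet {K : ℕ} (a b : Fin K → EReal) {ε : ℝ} (hε : 0 ≤ ε) :
    offsetSet (intervalUnion a b) ε ⊆ outerSet a b ε := by
  intro x hx
  rw [mem_offsetSet_of_nonneg hε] at hx
  have hle : Metric.infEDist x (intervalUnion a b) ≤ ENNReal.ofReal ε := by
    rcases hx with hx | hx
    · rw [Metric.infEDist_zero_of_mem hx]; exact zero_le
    · exact hx
  by_contra hout
  simp only [outerSet, mem_ofPred_eq, not_exists, not_and_or, not_le] at hout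
  -- The finitely many strict inequalities leave room for a radius `ε' > ε`, which makes the
  -- distance exceed `ε`.
  have hev : ∀ᶠ ε' in 𝓝[>] ε, ∀ i,
      ((x + ε' : ℝ) : EReal) < a i ∨ b i < ((x - ε' : ℝ) : EReal) := by
    refine eventually_all.2 fun i => ?_
    rcases hout i with h | h
    · have : ContinuousAt (fun ε' : ℝ => ((x + ε' : ℝ) : EReal)) ε :=
        (continuous_coe_real_ereal.comp (continuous_const.add continuous_id)).continuousAt
      exact ((this.eventually_lt_const h).filter_mono nhdsWithin_le_nhds).mono fun _ => Or.inl
    · have : ContinuousAt (fun ε' : ℝ => ((x - ε' : ℝ) : EReal)) ε :=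
        (continuous_coe_real_ereal.comp (continuous_const.sub continuous_id)).continuousAt
      exact ((this.eventually_const_lt h).filter_mono nhdsWithin_le_nhds).mono fun _ => Or.inr
  obtain ⟨ε', hε', hlt⟩ := (hev.and self_mem_nhdsWithin).exists
  have hlt : ε < ε' := hlt
  have hge : ENNReal.ofReal ε' ≤ Metric.infEDist x (intervalUnion a b) := by
    refine Metric.le_infEDist.2 fun y hy => ?_
    rw [edist_dist]
    refine ENNReal.ofReal_le_ofReal ?_
    by_contra! hd
    obtain ⟨i, hi₁, hi₂⟩ := hy
    rw [Real.dist_eq, abs_lt] at hd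
    rcases hε' i with h | h
    · have := hi₁.trans_le (EReal.coe_le_coe_iff.2 (show y ≤ x + ε' by linarith))
      exact lt_asymm h this
    · have := lt_of_le_of_lt (EReal.coe_le_coe_iff.2 (show x - ε' ≤ y by linarith)) hi₂
      exact lt_asymm h this
  exact absurd ((ENNReal.ofReal_le_ofReal_iff hε).1 (hge.trans hle)) (not_le.2 hlt)

theorem compl_offsetSet_subset_innerCompl {K : ℕ} (a b : Fin K → EReal) {ε : ℝ} (hε : 0 ≤ ε) :
    (offsetSet (intervalUnion a b) (-ε))ᶜ ⊆ innerCompl a b ε := by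
  rintro x hx i ⟨hi₁, hi₂⟩
  refine hx ?_
  have hxA : x ∈ intervalUnion a b := ⟨i,
    hi₁.trans_le (EReal.coe_le_coe_iff.2 (by linarith)),
    lt_of_le_of_lt (EReal.coe_le_coe_iff.2 (by linarith)) hi₂⟩
  rcases hε.eq_or_lt with rfl | hε
  · rw [neg_zero]
    exact (mem_offsetSet_of_nonneg le_rfl).2 (Or.inl hxA)
  · refine (mem_offsetSet_neg_of_pos hε).2 ⟨hxA, Metric.le_infEDist.2 fun y hy => ?_⟩
    rw [edist_dist]
    refine ENNReal.ofReal_le_ofReal ?_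
    by_contra! hd
    rw [Real.dist_eq, abs_lt] at hd
    exact hy ⟨i, hi₁.trans_le (EReal.coe_le_coe_iff.2 (by linarith)),
      lt_of_le_of_lt (EReal.coe_le_coe_iff.2 (by linarith)) hi₂⟩

/-! ### Optimality -/

theorem dataMeasure_eq_labelMeasure {w : Fin 2 → ℝ} {ρ : Fin 2 → ℝ → ℝ} (hw : ∀ y, 0 ≤ w y)
    (hρ : ∀ y, Continuous (ρ y)) :
    dataMeasure w ρ = labelMeasure fun y => densityMeasure fun x => w y * ρ y x := by
  refine Finset.sum_congr rfl fun y _ => ?_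
  rw [← Measure.map_smul, ← withDensity_smul _ (hρ y).measurable.ennreal_ofReal]
  congr 2
  ext x
  simp [ENNReal.ofReal_mul (hw y)]

theorem densityMeasure_real_apply {w : ℝ} {ρ : ℝ → ℝ} (hw : 0 ≤ w) (hρ : IsProbDensity ρ)
    {S : Set ℝ} (hS : MeasurableSet S) :
    (densityMeasure fun x => w * ρ x).real S = w * ∫ x in S, ρ x := by
  rw [← MeasureTheory.integral_const_mul, measureReal_def, densityMeasure_apply hS,
    ← ofReal_integral_eq_lintegral_ofReal (hρ.integrable.const_mul w).integrableOn
      (ae_of_all _ fun x => mul_nonneg hw (hρ.nonneg x)), ENNReal.toReal_ofReal]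
  exact integral_nonneg fun x => mul_nonneg hw (hρ.nonneg x)

theorem isFiniteMeasure_densityMeasure {f : ℝ → ℝ} (hf : Integrable f) :
    IsFiniteMeasure (densityMeasure f) :=
  isFiniteMeasure_withDensity_ofReal hf.2

/-- A matching as large as the adversarial risk of `A` yields an optimal coupling, and certifies
that `A` is optimal. -/
theorem optimal_of_matching {w : Fin 2 → ℝ} {ρ : Fin 2 → ℝ → ℝ} (hw : ∀ y, 0 ≤ w y)
    (hw_sum : w 0 + w 1 = 1) (hρ : ∀ y, IsProbDensity (ρ y)) (hc : ∀ y, Continuous (ρ y))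
    {ε : ℝ} (hε : 0 ≤ ε) {A : Set ℝ} (hA : MeasurableSet A) (hfr : volume (frontier A) = 0)
    {τ : Measure (ℝ × ℝ)} (h₀ : τ.fst ≤ densityMeasure fun x => w 0 * ρ 0 x)
    (h₁ : τ.snd ≤ densityMeasure fun x => w 1 * ρ 1 x) (hd : ∀ᵐ z ∂τ, dist z.1 z.2 ≤ 2 * ε)
    (hτ : densityMeasure (fun x => w 0 * ρ 0 x) (offsetSet A ε) +
      densityMeasure (fun x => w 1 * ρ 1 x) (offsetSet A (-ε))ᶜ ≤ τ univ) :
    (∃ π ∈ couplings (dataMeasure w ρ) (swapLabels (dataMeasure w ρ)),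
      w 1 * (∫ x in offsetSet A (-ε), ρ 1 x) - w 0 * (∫ x in offsetSet A ε, ρ 0 x)
        = 1 / 2 * (∫ z, transportCost ε z.1 z.2 ∂π) + 1 / 2 * (w 1 - w 0)) ∧
    IsRobustOptimal (dataMeasure w ρ) ε A := by
  rw [dataMeasure_eq_labelMeasure hw hc]
  set μ : Fin 2 → Measure ℝ := fun y => densityMeasure fun x => w y * ρ y x with hμ
  have hfin : ∀ y, IsFiniteMeasure (μ y) := fun y =>
    isFiniteMeasure_densityMeasure ((hρ y).integrable.const_mul (w y))
  have hac : ∀ y, μ y ≪ volume := fun y => withDensity_absolutelyContinuous _ _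
  have huniv : ∀ y, (μ y).real univ = w y := fun y => by
    rw [hμ, densityMeasure_real_apply (hw y) (hρ y) MeasurableSet.univ, setIntegral_univ,
      (hρ y).integral_eq_one, mul_one]
  have hmass : labelMeasure μ univ = 1 := by
    rw [labelMeasure_apply _ MeasurableSet.univ]
    change μ 0 univ + μ 1 univ = 1
    rw [← ofReal_measureReal, ← ofReal_measureReal, huniv, huniv,
      ← ENNReal.ofReal_add (hw 0) (hw 1), hw_sum, ENNReal.ofReal_one]
  obtain ⟨π, hπ, hle⟩ := exists_coupling_of_matching μ hmass τ h₀ h₁ hd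
  have hprob := hπ.1
  set C : Set (Datum × Datum) := {z | 2 * ε < dist z.1.1 z.2.1 ∨ z.1.2 ≠ z.2.2} with hC
  have hR := robustRisk_le_offsetSet μ hac hε hA hfr
  have hweak : ∀ B : Set ℝ, MeasurableSet B →
      1 ≤ 2 * robustRisk (labelMeasure μ) ε (classifier B) + π C := fun B hB =>
    one_le_two_mul_robustRisk_add μ hac hε hπ hB
  set M := μ 0 (offsetSet A ε) + μ 1 (offsetSet A (-ε))ᶜ with hM
  -- The matching gives `≤ 1`; weak duality for `A` with the upper bound on its risk gives `≥ 1`.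
  have hMC : 2 * M + π C = 1 := by
    refine le_antisymm (le_trans ?_ hle) ((hweak A hA).trans ?_)
    · gcongr
    · gcongr
  refine ⟨⟨π, hπ, ?_⟩, hA, fun B hB => hR.trans ?_⟩
  · have hreal : 2 * M.toReal + π.real C = 1 := by
      have hMtop : M ≠ ∞ := ENNReal.add_ne_top.2 ⟨measure_ne_top _ _, measure_ne_top _ _⟩
      rw [measureReal_def, ← ENNReal.toReal_one, ← hMC, ENNReal.toReal_add
        (ENNReal.mul_ne_top (by simp) hMtop) (measure_ne_top _ _), ENNReal.toReal_mul,
        ENNReal.toReal_ofNat]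
    have hMreal : M.toReal = (μ 0).real (offsetSet A ε) + (μ 1).real (offsetSet A (-ε))ᶜ :=
      ENNReal.toReal_add (measure_ne_top _ _) (measure_ne_top _ _)
    have hm := measurableSet_offsetSet hA (-ε)
    rw [measureReal_compl hm, huniv] at hMreal
    rw [integral_transportCost, ← hC, ← densityMeasure_real_apply (hw 1) (hρ 1) hm,
      ← densityMeasure_real_apply (hw 0) (hρ 0) (measurableSet_offsetSet hA ε)]
    change (μ 1).real _ - (μ 0).real _ = _
    linarith
  · have h2 : 2 * M ≤ 2 * robustRisk (labelMeasure μ) ε (classifier B) := by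
      have := hweak B hB
      rw [← hMC] at this
      exact (ENNReal.add_le_add_iff_right (measure_ne_top π C)).1 this
    exact (ENNReal.mul_le_mul_iff_right (by simp) (by simp)).1 h2

end AdvClass

end

/-! ### The theorem: choice of the window size and of the time horizon -/

open AdvClass
theorem mainTheorem1 (w : Fin 2 → ℝ) (ρ : Fin 2 → ℝ → ℝ)
    (hw : ∀ y, 0 ≤ w y) (hw_sum : w 0 + w 1 = 1)
    (hρ : ∀ y, IsProbDensity (ρ y))
    (hreg : ∀ y, ContDiff ℝ 1 (ρ y))
    (hfin : {t : ℝ | w 0 * ρ 0 t = w 1 * ρ 1 t ∧ 0 < w 1 * ρ 1 t}.Finite)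
    (hnd : ∀ t : ℝ, w 0 * ρ 0 t = w 1 * ρ 1 t → 0 < w 1 * ρ 1 t →
      w 0 * deriv (ρ 0) t ≠ w 1 * deriv (ρ 1) t)
    (A₀ : Set ℝ) (hA₀ : IsBayesSet w ρ A₀)
    (hpos : ∀ t ∈ frontier A₀, 0 < w 0 * ρ 0 t + w 1 * ρ 1 t) :
    ∃ (K : ℕ) (a₀ b₀ : Fin K → EReal), IsBoundary A₀ a₀ b₀ ∧
      ∃ ε₀ : ℝ, 0 < ε₀ ∧
        (∃ a b : Fin K → ℝ → EReal, SolvesEvolution w ρ ε₀ a₀ b₀ a b) ∧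
        ∀ a b : Fin K → ℝ → EReal, SolvesEvolution w ρ ε₀ a₀ b₀ a b →
          ∀ ε ∈ Set.Icc (0 : ℝ) ε₀,
            (∃ π ∈ couplings (dataMeasure w ρ) (swapLabels (dataMeasure w ρ)),
              w 1 * (∫ x in offsetSet (intervalUnion (fun i => a i ε) (fun i => b i ε)) (-ε),
                  ρ 1 x)
                - w 0 * (∫ x in offsetSet (intervalUnion (fun i => a i ε) (fun i => b i ε)) ε,
                  ρ 0 x)
              = 1 / 2 * (∫ z, transportCost ε z.1 z.2 ∂π) + 1 / 2 * (w 1 - w 0)) ∧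
            IsRobustOptimal (dataMeasure w ρ) ε
              (intervalUnion (fun i => a i ε) (fun i => b i ε)) := by
  have hcont : ∀ y, Continuous (ρ y) := fun y => (hreg y).continuous
  have hder : ∀ y x, HasDerivAt (fun x => w y * ρ y x) (w y * deriv (ρ y) x) x := fun y x =>
    (((hreg y).differentiable one_ne_zero) x).hasDerivAt.const_mul (w y)
  have hsmooth : ∀ y, ContDiff ℝ 1 (fun x => w y * ρ y x) := fun y => contDiff_const.mul (hreg y)
  have hder' : ∀ y, Continuous fun x => w y * deriv (ρ y) x := fun y =>
    continuous_const.mul ((hreg y).continuous_deriv le_rfl)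
  have hnn : ∀ y x, 0 ≤ w y * ρ y x := fun y x => mul_nonneg (hw y) ((hρ y).nonneg x)
  have hposf : ∀ t ∈ frontier A₀, w 0 * ρ 0 t = w 1 * ρ 1 t → 0 < w 1 * ρ 1 t := fun t ht he => by
    have := hpos t ht
    linarith
  obtain ⟨hout, K, a₀, b₀, hB, ha₀, hb₀⟩ := exists_isBoundary (hder 0) (hder 1) (A := A₀)
    (fun x => (hA₀ x).1) (fun x => (hA₀ x).2)
    (hfin.subset fun t ht => ⟨ht.2, hposf t ht.1 ht.2⟩)
    (fun t ht he => hnd t he (hposf t ht he))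
  refine ⟨K, a₀, b₀, hB, ?_⟩
  have haa : ∀ i j, i < j → a₀ i < a₀ j := fun i j h => (hB.lt i).trans (hB.lt_of_lt i j h)
  have sep : ∀ {u v : Fin K → EReal}, (∀ i j, i < j → u i < v j) →
      ∀ᶠ δ in nhdsWithin (0 : ℝ) (Ioi 0), ∀ i j, i < j → Separated δ (u i) (v j) := fun h =>
    Filter.eventually_all.2 fun i => Filter.eventually_all.2 fun j => by
      by_cases hij : i < j
      · exact (eventually_separated (h i j hij)).mono fun _ hs _ => hs
      · exact Filter.Eventually.of_forall fun _ h => absurd h hij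
  -- The window size `δ` is fixed first, by the gaps between the endpoints; the horizon `T` is then
  -- chosen for this `δ`.
  obtain ⟨δ, sab, sba, saa, sbb, sab', hδ⟩ :=
    ((Filter.eventually_all.2 fun i => eventually_separated (hB.lt i)).and
      ((sep hB.lt_of_lt).and ((sep haa).and
        ((sep fun i j h => (hB.lt_of_lt i j h).trans (hB.lt j)).and
          ((sep fun i j h => (haa i j h).trans (hB.lt j)).and self_mem_nhdsWithin))))).exists
  have hδ : 0 < δ := hδ
  -- Left endpoints are upcrossings of the pair of classes (0, 1), right endpoints of (1, 0).
  obtain ⟨T, hTa, hTb, hT⟩ :=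
    ((Filter.eventually_all.2 fun i => eventually_endpointEvolves (hder 0) (hder 1) (hsmooth 0)
      (hsmooth 1) (hder' 0) (hder' 1) (hnn 0) (hnn 1) (ha₀ i) hδ).and
      ((Filter.eventually_all.2 fun i => eventually_endpointEvolves (hder 1) (hder 0) (hsmooth 1)
        (hsmooth 0) (hder' 1) (hder' 0) (hnn 1) (hnn 0) (hb₀ i) hδ).and
        self_mem_nhdsWithin)).exists
  choose a ha using fun i => (hTa i).1
  choose b hb using fun i => (hTb i).1
  refine ⟨T, hT, ⟨a, b, fun i => ⟨ha i, hb i⟩⟩, fun a b hab ε hε => ?_⟩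
  choose Ja σa hJa using fun i => (hTa i).2 (a i) (hab i).1 ε hε
  choose Jb σb hJb using fun i => (hTb i).2 (b i) (hab i).2 ε hε
  obtain ⟨τ, hτ₀, hτ₁, hτd, hτ⟩ := exists_matching_of_isWindow (hsmooth 0).continuous hδ hε.1
    (fun x hx => (hA₀ x).1 (interior_subset (hB.union_eq ▸ hx)))
    (fun x hx => hout x (hB.union_eq ▸ hx)) sab sba saa sbb sab' hJa hJb
  refine optimal_of_matching hw hw_sum hρ hcont hε.1
    (isOpen_intervalUnion _ _).measurableSet (volume_frontier_intervalUnion _ _) hτ₀ hτ₁ hτd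
    (le_trans (add_le_add (measure_mono (offsetSet_subset_outerSet _ _ hε.1))
      (measure_mono (compl_offsetSet_subset_innerCompl _ _ hε.1))) hτ)
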